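/- **Setting.** Let $N\ge 1$, let $L(\mathbf x_i|\cdot):\mathbb R^d\to\mathbb R$ ($1\le i\le N$) be differentiable with $C_N$-Lipschitz gradients ($C_N>0$), and let $L(\beta)=\sum_{i=1}^N L(\mathbf x_i|\beta)$ be $(a,b)$-dissipative: $\langle\beta,\nabla L(\beta)\rangle\ge a\|\beta\|^2-b$ with $a>0$, $b\ge0$. Put $C_L=NC_N$, let $0<\tau^{(1)}<\tau^{(2)}$, and put $\Delta=1/\tau^{(1)}-1/\tau^{(2)}$. A mini-batch $B$ of size $n$ consists of $n$ independent uniform draws from $\{1,\dots,N\}$. For a pair $\beta=(\beta^{(1)},\beta^{(2)})$ and a pair of snapshots $\widehat\beta=(\widehat\beta^{(1)},\widehat\beta^{(2)})$ put $$\widetilde L(B|\beta^{(h)})=\tfrac Nn\sum_{i\in B}\big[L(\mathbf x_i|\beta^{(h)})-L(\mathbf x_i|\widehat\beta^{(h)})\big]+L(\widehat\beta^{(h)}),\qquad \widetilde\sigma^2=\mathrm{Var}_B\big(\widetilde L(B|\beta^{(1)})-\widetilde L(B|\beta^{(2)})\big),$$ $$S=e^{\Delta(L(\beta^{(1)})-L(\beta^{(2)}))},\qquad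 \widetilde S_{\eta,m,n}=\exp\Big\{\Delta\Big(\widetilde L(B|\beta^{(1)})-\widetilde L(B|\beta^{(2)})-\Delta\tfrac{\widetilde\sigma^2}{2}\Big)\Big\},$$ where the same $B$ serves both chains, and let $v=\Delta^2\widetilde\sigma^2$ be the variance of $\log\widetilde S_{\eta,m,n}$. Expectations $\mathbb E_B$ are over the mini-batch, at fixed $\beta,\widehat\beta$. The algorithm (VR-reSGLD with learning rate $\eta$, period $m$, batch size $n$, swapping intensity $r\ge 0$) is: $\beta_0$ is random with $\mathbb E\|\beta_0^{(h)}\|^2\le M_0$ for $h\in\{1,2\}$; iteration $k\ge1$ draws, independently of the past, a mini-batch $B_k$, standard Gaussian vectors $\xi_k^{(1)},\xi_k^{(2)}$ and a uniform variable on $[0,1]$, all independent; it performs the Langevin steps $\beta^{(h)}_k=\bar\beta^{(h)}_{k-1}-\eta\frac Nn\sum_{i\in B_k}\nabla L(\mathbf x_i|\bar\beta^{(h)}_{k-1})+\sqrt{2\eta\tau^{(h)}}\,\xi^{(h)}_k$ and then, by comparing the uniform variable with $r\eta\min\{1,\widetilde S_{\eta,m,n}\}$, evaluated at $B_k$, $\beta_k$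 and the snapshot $\widehat\beta_k=\beta_{m\lfloor k/m\rfloor}$, either swaps the two components ($\bar\beta_k=(\beta_k^{(2)},\beta_k^{(1)})$, if the uniform variable is smaller) or not ($\bar\beta_k=\beta_k$); $\bar\beta_0=\beta_0$. **Lemma.** For all $R$, $M_0$ and $r\ge0$ there are constants $A,C>0$, depending only on $R$, $M_0$, $r$, the temperatures, and the energies $L(\mathbf x_i|\cdot)$ with the constants $C_N,a,b$ (not on $n,m,\eta,k$), such that the following holds. 1. For all $n\ge1$ and all $\beta^{(h)},\widehat\beta^{(h)}$ in the centred ball of radius $R$ we have $v\le C/n$ and $$e^{-C\left(\sqrt v+\frac1{n^2}\right)}\,\mathcal M\;\le\;\mathbb E_B\big[\min\{1,\widetilde S_{\eta,m,n}\}\big]\;\le\;\mathcal M:=\min\Big\{1,\;S\Big(\frac{A}{n^2}+e^{-q}\Big)\Big\},$$ with the exponent $q=\max\{0,\ \frac v8-\frac12\max\{0,-\log S\}\}$, so that $0\le q\le v/8$, and $q=v/8$ if $S\ge1$. In particular $\mathbb E_B[\min\{1,\widetilde S_{\eta,m,n}\}]/\mathcal M\to1$ as $n\to\infty$, uniformly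 on the ball. 2. The exponent is of order $m^2\eta/n$ along the algorithm: for all $n,m\ge1$, all $0<\eta<\min\{1,a/C_L^2\}$, every run of the algorithm and every $k\ge0$, if $v_k$ denotes $v$ at $\beta=\beta_k$, $\widehat\beta=\widehat\beta_k$, then $$\mathbb E\Big[v_k\,\mathbf 1\big\{\|\beta_k^{(h)}\|\le R,\ \|\widehat\beta_k^{(h)}\|\le R,\ h=1,2\big\}\Big]\le C\,\frac{m^2\eta}{n}.$$ -/

import Mathlib

open MeasureTheory ProbabilityTheory
open scoped Gradient

namespace VRReSGLD

/-- The parameter space `ℝ^d` with the Euclidean norm. -/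
abbrev Param (d : ℕ) : Type := EuclideanSpace ℝ (Fin d)

/-- A pair of parameters, one for each chain. Chain `0` is the low-temperature chain,
chain `1` the high-temperature chain. -/
abbrev Pair (d : ℕ) : Type := Fin 2 → Param d

variable {N d : ℕ}

/-- The energy of the full data set, `L(β) = ∑ i, L(x_i | β)`. -/
noncomputable def energy (L : Fin N → Param d → ℝ) (x : Param d) : ℝ := ∑ i, L i x

/-- Smoothness (each `L(x_i | ·)` is differentiable with `CN`-Lipschitz gradient) and
`(a, b)`-dissipativity of the full energy. -/
structure SmoothDissipative (L : Fin N → Param d → ℝ) (CN a b : ℝ) : Prop where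
  CN_pos : 0 < CN
  a_pos : 0 < a
  b_nonneg : 0 ≤ b
  differentiable : ∀ i, Differentiable ℝ (L i)
  smooth : ∀ i x y, ‖∇ (L i) x - ∇ (L i) y‖ ≤ CN * ‖x - y‖
  dissipative : ∀ x : Param d, a * ‖x‖ ^ 2 - b ≤ inner ℝ x (∇ (energy L) x)

/-- The law of a mini-batch: `n` independent uniform draws from the `N` data points. -/
noncomputable def batchLaw (n N : ℕ) : Measure (Fin n → Fin N) :=
  Measure.pi fun _ => uniformOn Set.univ

/-- The mini-batch gradient `(N / n) ∑_{i ∈ B} ∇ L(x_i | β)`. -/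
noncomputable def batchGradient {n : ℕ} (L : Fin N → Param d → ℝ) (B : Fin n → Fin N)
    (x : Param d) : Param d :=
  ((N : ℝ) / n) • ∑ j, ∇ (L (B j)) x

/-- The variance-reduced energy estimator at `x` with control variate (snapshot) `y`. -/
noncomputable def vrEnergy {n : ℕ} (L : Fin N → Param d → ℝ) (B : Fin n → Fin N)
    (x y : Param d) : ℝ :=
  (N : ℝ) / n * ∑ j, (L (B j) x - L (B j) y) + energy L y

/-- The difference `1/τ⁽¹⁾ - 1/τ⁽²⁾` of the inverse temperatures. -/
noncomputable def invTempGap (τ : Fin 2 → ℝ) : ℝ := 1 / τ 0 - 1 / τ 1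

/-- The deterministic swapping rate `S(β⁽¹⁾, β⁽²⁾)`. -/
noncomputable def swapRate (L : Fin N → Param d → ℝ) (τ : Fin 2 → ℝ) (x : Pair d) : ℝ :=
  Real.exp (invTempGap τ * (energy L (x 0) - energy L (x 1)))

/-- The variance, over the mini-batch of size `n` (shared by the two chains), of the difference
of the two variance-reduced energy estimators at the parameters `x` with snapshots `y`. -/
noncomputable def vrVariance (L : Fin N → Param d → ℝ) (n : ℕ) (x y : Pair d) : ℝ :=
  Var[fun B => vrEnergy L B (x 0) (y 0) - vrEnergy L B (x 1) (y 1); batchLaw n N]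

/-- The variance-reduced stochastic swapping rate. -/
noncomputable def vrSwapRate {n : ℕ} (L : Fin N → Param d → ℝ) (τ : Fin 2 → ℝ)
    (B : Fin n → Fin N) (x y : Pair d) : ℝ :=
  Real.exp (invTempGap τ * (vrEnergy L B (x 0) (y 0) - vrEnergy L B (x 1) (y 1)
    - invTempGap τ * (vrVariance L n x y / 2)))

/-- The expectation over the mini-batch of the truncated variance-reduced swapping rate. -/
noncomputable def expTruncSwapRate (L : Fin N → Param d → ℝ) (τ : Fin 2 → ℝ) (n : ℕ)
    (x y : Pair d) : ℝ :=
  ∫ B, min 1 (vrSwapRate L τ B x y) ∂(batchLaw n N)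

/-- The variance `v = (1/τ⁽¹⁾ - 1/τ⁽²⁾)² σ²` of the logarithm of the stochastic swapping rate. -/
noncomputable def logVariance (L : Fin N → Param d → ℝ) (τ : Fin 2 → ℝ) (n : ℕ)
    (x y : Pair d) : ℝ :=
  invTempGap τ ^ 2 * vrVariance L n x y

/-- The exponent of the variance penalty for the rate `S` and log-variance `v`: it is `v / 8`
when `1 ≤ S`, and `v / 8` lowered by `log (1 / S) / 2`, but not below `0`, when `S < 1`. -/
noncomputable def penalty (S v : ℝ) : ℝ := max 0 (v / 8 - max 0 (-Real.log S) / 2)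

/-- `min {1, S (A / n² + exp (-q))}` with `q` the penalty exponent at `x`, `y`. -/
noncomputable def approxRate (L : Fin N → Param d → ℝ) (τ : Fin 2 → ℝ) (A : ℝ) (n : ℕ)
    (x y : Pair d) : ℝ :=
  min 1 (swapRate L τ x *
    (A / (n : ℝ) ^ 2 + Real.exp (-penalty (swapRate L τ x) (logVariance L τ n x y))))

/-- The randomness of one iteration: the mini-batch, the two Gaussian vectors, and the uniform
variable which decides about the swap. -/
abbrev Noise (n N d : ℕ) : Type := (Fin n → Fin N) × (Fin 2 → Param d) × ℝ

/-- The law of the randomness of one iteration. -/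
noncomputable def noiseLaw (n N d : ℕ) : Measure (Noise n N d) :=
  (batchLaw n N).prod
    ((Measure.pi fun _ : Fin 2 => stdGaussian (Param d)).prod (volume.restrict (Set.Icc 0 1)))

open Classical in
/-- A run of variance-reduced replica exchange SGLD with learning rate `η`, snapshot period `m`,
batch size `n`, temperatures `τ 0`, `τ 1` and swapping intensity `r` on `(Ω, P)`. Here `β k` is
the pair of parameters after the Langevin step of iteration `k`, at which the energy estimators
of iteration `k` are evaluated with the snapshot `β (m * (k / m))`, and `post k` is the pair after
the swap step of iteration `k`, from which the next Langevin step starts. The swap is accepted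
with probability `r η min {1, S̃}`. -/
structure IsRun {Ω : Type*} [MeasurableSpace Ω] (P : Measure Ω) (L : Fin N → Param d → ℝ)
    (τ : Fin 2 → ℝ) (r η : ℝ) (m n : ℕ) (ζ : ℕ → Ω → Noise n N d)
    (β post : ℕ → Ω → Pair d) : Prop where
  measurable_noise : ∀ k, Measurable (ζ k)
  law_noise : ∀ k, P.map (ζ k) = noiseLaw n N d
  indep_noise : iIndepFun ζ P
  measurable_init : Measurable (β 0)
  indep_init : IndepFun (β 0) (fun ω k => ζ k ω) P
  post_zero : post 0 = β 0
  langevin : ∀ k ω h, β (k + 1) ω h =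
    post k ω h - η • batchGradient L (ζ (k + 1) ω).1 (post k ω h)
      + √(2 * η * τ h) • (ζ (k + 1) ω).2.1 h
  swap : ∀ k ω, post (k + 1) ω =
    if (ζ (k + 1) ω).2.2 < r * η *
        min 1 (vrSwapRate L τ (ζ (k + 1) ω).1 (β (k + 1) ω) (β (m * ((k + 1) / m)) ω))
    then fun h => β (k + 1) ω h.rev
    else β (k + 1) ω

end VRReSGLD

/-!
At fixed parameters and snapshots, the logarithm of the stochastic swapping rate is
`log S + Z - v / 2`, where `Z` is an average over the mini-batch of centred terms that are bounded
on the ball, and `v = Var Z = O(1 / n)` (`vrSwapRate_eq`, `logVariance_eq`, `logVariance_le`).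

For the upper bound, the exponential moments of `Z` at `t = 1 / 2` and `t = 1` agree with the
Gaussian ones up to a factor `1 + O(1 / n²)`, since the third cumulant of `Z` is of order `1 / n²`
(`integral_exp_batchMean_le`). If `q = 0`, one uses `min {1, x} ≤ x` and `t = 1`; if `q > 0`, then
`min {1, x} ≤ √x` and `t = 1 / 2` produce `√S exp (-v / 8) ≤ S exp (-q)`. For the lower bound,
`min {1, S u} ≥ min {1, S} min {1, u}`, Jensen's inequality and `E |Z| ≤ √v` suffice, because
the approximate rate is at most `exp (A / n²) min {1, S}` (`le_integral_min_one`).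

Along the algorithm, `v` is at most a constant times the squared distance from the snapshot,
divided by `n` (`SmoothDissipative.logVariance_le_dist`). This distance is accumulated over less
than `m` iterations. In each of them the expected squared displacement is `O(η)`: the Langevin
step contributes its gradient and diffusion terms, and a swap happens only if the uniform variable,
which is independent of the pair to be swapped, is below `r η`
(`IsRun.lintegral_sqNorm_succ_sub_le`). Cauchy–Schwarz over the iterations yields `m² η`. All this
needs a second-moment bound that is uniform in the iteration; it follows from dissipativity, as
swaps preserve the total squared norm of the pair (`IsRun.lintegral_sqNorm_le`).
-/

namespace VRReSGLD

/-! ### Averages over a mini-batch -/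

instance isProbabilityMeasure_batchLaw (n N : ℕ) [NeZero N] :
    IsProbabilityMeasure (batchLaw n N) := by
  unfold batchLaw; infer_instance

lemma integral_uniformOn_univ {E : Type*} [NormedAddCommGroup E] [NormedSpace ℝ E] [CompleteSpace E]
    {N : ℕ} [NeZero N] (f : Fin N → E) :
    ∫ i, f i ∂(uniformOn Set.univ) = (N : ℝ)⁻¹ • ∑ i, f i := by
  rw [integral_fintype Integrable.of_finite, Finset.smul_sum]
  refine Finset.sum_congr rfl fun i _ => ?_
  simp [Measure.real, uniformOn_univ]

/-- The average of `X` over the mini-batch `B`. -/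
noncomputable def batchMean {n N : ℕ} (X : Fin N → ℝ) (B : Fin n → Fin N) : ℝ :=
  (∑ j, X (B j)) / n

lemma integral_batchMean {n N : ℕ} [NeZero N] (X : Fin N → ℝ) (hX : ∑ i, X i = 0) :
    ∫ B, batchMean X B ∂(batchLaw n N) = 0 := by
  unfold batchMean batchLaw
  rw [integral_div, integral_finsetSum _ fun _ _ => Integrable.of_finite]
  simp [integral_comp_eval (μ := fun _ : Fin n => (uniformOn Set.univ : Measure (Fin N)))
    (f := X) (by fun_prop), integral_uniformOn_univ, hX]

lemma variance_batchMean {n N : ℕ} [NeZero N] (X : Fin N → ℝ) (hX : ∑ i, X i = 0) :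
    Var[batchMean X; batchLaw n N] = (∫ i, X i ^ 2 ∂(uniformOn Set.univ)) / n := by
  have h1 : (batchMean X : (Fin n → Fin N) → ℝ)
      = fun B => (n : ℝ)⁻¹ * (∑ j, fun B : Fin n → Fin N => X (B j)) B := by
    ext B; simp [batchMean, div_eq_inv_mul]
  rw [h1, variance_const_mul, batchLaw, variance_sum_pi fun _ => MemLp.of_discrete]
  rw [variance_of_integral_eq_zero (by fun_prop) (by simp [integral_uniformOn_univ, hX])]
  rcases eq_or_ne n 0 with rfl | hn
  · simp
  · have : (n : ℝ) ≠ 0 := by exact_mod_cast hn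
    simp
    field_simp

lemma integral_abs_batchMean_le {n N : ℕ} [NeZero N] (X : Fin N → ℝ) (hX : ∑ i, X i = 0) :
    ∫ B, |batchMean X B| ∂(batchLaw n N) ≤ √(Var[batchMean X; batchLaw n N]) := by
  apply Real.le_sqrt_of_sq_le
  have h := variance_nonneg (fun B => |batchMean X B|) (batchLaw n N)
  rw [variance_eq_sub MemLp.of_discrete] at h
  rw [variance_of_integral_eq_zero (X := batchMean X) (by fun_prop) (integral_batchMean X hX)]
  simpa [Pi.pow_apply] using h

lemma exp_le_cubic (y : ℝ) : Real.exp y ≤ 1 + y + y ^ 2 / 2 + |y| ^ 3 * Real.exp |y| := by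
  have h := Complex.norm_exp_sub_sum_le_norm_mul_exp (y : ℂ) 3
  simp only [Finset.sum_range_succ, Finset.sum_range_zero, Complex.norm_real,
    Real.norm_eq_abs] at h
  norm_cast at h
  have h2 := (le_abs_self _).trans h
  norm_num [Nat.factorial] at h2
  linarith

/-- The moment generating function of a centred batch average exceeds the Gaussian one at most by
a factor `exp (O (1 / n²))`: the first cumulant at which they differ is the third. -/
lemma integral_exp_batchMean_le {n N : ℕ} [NeZero N] (hn : 1 ≤ n) (X : Fin N → ℝ)
    (hX : ∑ i, X i = 0) {K : ℝ} (hK : ∀ i, |X i| ≤ K) {t : ℝ} (ht0 : 0 ≤ t) (ht1 : t ≤ 1) :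
    ∫ B, Real.exp (t * batchMean X B) ∂(batchLaw n N)
      ≤ Real.exp (t ^ 2 * Var[batchMean X; batchLaw n N] / 2
          + K ^ 3 * Real.exp K / (n : ℝ) ^ 2) := by
  have hn' : (1 : ℝ) ≤ n := by exact_mod_cast hn
  have hn0 : (0 : ℝ) < n := by linarith
  have hK0 : 0 ≤ K := (abs_nonneg _).trans (hK 0)
  have h1 : ∀ B : Fin n → Fin N, Real.exp (t * batchMean X B)
      = ∏ j, Real.exp (t * X (B j) / n) := by
    intro B
    rw [← Real.exp_sum, batchMean, ← Finset.sum_div, ← Finset.mul_sum, mul_div_assoc]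
  simp_rw [h1]
  rw [batchLaw, integral_fintype_prod_eq_pow (fun i : Fin N => Real.exp (t * X i / n))]
  set s := ∫ i, X i ^ 2 ∂(uniformOn Set.univ : Measure (Fin N)) with hs
  have h2 : ∫ i, Real.exp (t * X i / n) ∂(uniformOn Set.univ : Measure (Fin N))
      ≤ ∫ i, (1 + t / n * X i + t ^ 2 / (2 * n ^ 2) * X i ^ 2
        + K ^ 3 * Real.exp K / (n : ℝ) ^ 3) ∂(uniformOn Set.univ : Measure (Fin N)) := by
    refine integral_mono Integrable.of_finite Integrable.of_finite fun i => ?_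
    have h3 : |t * X i / n| ≤ K / n := by
      rw [abs_div, abs_mul, abs_of_nonneg ht0, abs_of_pos hn0]
      gcongr
      nlinarith [hK i, abs_nonneg (X i)]
    have h4 : K / n ≤ K := div_le_self hK0 hn'
    calc Real.exp (t * X i / n)
        ≤ 1 + t * X i / n + (t * X i / n) ^ 2 / 2
          + |t * X i / n| ^ 3 * Real.exp |t * X i / n| := exp_le_cubic _
      _ ≤ 1 + t * X i / n + (t * X i / n) ^ 2 / 2 + (K / n) ^ 3 * Real.exp K := by
          gcongr
          exact h3.trans h4
      _ = _ := by field_simp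
  have h3 : ∫ i, (1 + t / n * X i + t ^ 2 / (2 * n ^ 2) * X i ^ 2
        + K ^ 3 * Real.exp K / (n : ℝ) ^ 3) ∂(uniformOn Set.univ : Measure (Fin N))
      = 1 + t ^ 2 / (2 * n ^ 2) * s + K ^ 3 * Real.exp K / (n : ℝ) ^ 3 := by
    rw [integral_add Integrable.of_finite Integrable.of_finite,
      integral_add Integrable.of_finite Integrable.of_finite,
      integral_add Integrable.of_finite Integrable.of_finite, integral_const_mul,
      integral_const_mul, integral_uniformOn_univ X, hX]
    simp [hs]
  have h4 : ∫ i, Real.exp (t * X i / n) ∂(uniformOn Set.univ : Measure (Fin N))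
      ≤ Real.exp (t ^ 2 / (2 * n ^ 2) * s + K ^ 3 * Real.exp K / (n : ℝ) ^ 3) := by
    refine h2.trans (h3.le.trans ?_)
    have := Real.add_one_le_exp (t ^ 2 / (2 * n ^ 2) * s + K ^ 3 * Real.exp K / (n : ℝ) ^ 3)
    linarith
  refine (pow_le_pow_left₀ (integral_nonneg fun _ => (Real.exp_pos _).le) h4 _).trans ?_
  rw [← Real.exp_nat_mul, Fintype.card_fin]
  change _ ≤ Real.exp (t ^ 2 * Var[batchMean X; batchLaw n N] / 2 + _)
  rw [variance_batchMean X hX, ← hs]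
  apply le_of_eq
  congr 1
  field_simp

/-! ### The expected truncated rate of an abstract batch average -/

lemma exp_div_sq_le {c n : ℝ} (hc : 0 ≤ c) (hn : 1 ≤ n) :
    Real.exp (c / n ^ 2) ≤ 1 + c * Real.exp c / n ^ 2 := by
  set u := c / n ^ 2 with hu
  have hu0 : 0 ≤ u := by positivity
  have huc : u ≤ c := div_le_self hc (one_le_pow₀ hn)
  have h1 : 1 - u ≤ Real.exp (-u) := by linarith [Real.add_one_le_exp (-u)]
  have h2 : (1 - u) * Real.exp u ≤ 1 := by
    calc _ ≤ Real.exp (-u) * Real.exp u := by gcongr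
      _ = 1 := by rw [← Real.exp_add]; simp
  have h3 : u * Real.exp u ≤ u * Real.exp c := by gcongr
  have h4 : c * Real.exp c / n ^ 2 = u * Real.exp c := by rw [hu]; ring
  rw [h4]; linarith

lemma min_one_le_sqrt {x : ℝ} (hx : 0 ≤ x) : min 1 x ≤ √x := by
  apply Real.le_sqrt_of_sq_le
  rcases le_total x 1 with h | h
  · rw [min_eq_right h]; nlinarith
  · rw [min_eq_left h]; linarith

/-- The upper bound for the truncated rate. Where the penalty `q` is positive it comes from
`min {1, x} ≤ √x`, and the moment generating function at `1 / 2`; where `q = 0` it comes from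
`min {1, x} ≤ x`, and the moment generating function at `1`. -/
lemma integral_min_one_le {n N : ℕ} [NeZero N] (hn : 1 ≤ n) (X : Fin N → ℝ)
    (hX : ∑ i, X i = 0) {K : ℝ} (hK : ∀ i, |X i| ≤ K) {S v : ℝ} (hS : 0 < S)
    (hv : v = Var[batchMean X; batchLaw n N]) :
    ∫ B, min 1 (S * Real.exp (batchMean X B - v / 2)) ∂(batchLaw n N)
      ≤ min 1 (S * (K ^ 3 * Real.exp K * Real.exp (K ^ 3 * Real.exp K) / (n : ℝ) ^ 2
          + Real.exp (-penalty S v))) := by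
  have hn' : (1 : ℝ) ≤ n := by exact_mod_cast hn
  have hK0 : 0 ≤ K := (abs_nonneg _).trans (hK 0)
  set c := K ^ 3 * Real.exp K with hc
  have hc0 : 0 ≤ c := by positivity
  have hcn := exp_div_sq_le hc0 hn'
  have hv0 : 0 ≤ v := hv ▸ variance_nonneg _ _
  refine le_min ?_ ?_
  · calc _ ≤ ∫ B, (1 : ℝ) ∂(batchLaw n N) :=
          integral_mono Integrable.of_finite Integrable.of_finite fun B => min_le_left _ _
      _ = 1 := by simp
  have hbase : ∀ t : ℝ, 0 ≤ t → t ≤ 1 →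
      ∫ B, Real.exp (t * batchMean X B) ∂(batchLaw n N)
        ≤ Real.exp (t ^ 2 * v / 2) * (1 + c * Real.exp c / (n : ℝ) ^ 2) := by
    intro t h0 h1
    refine (integral_exp_batchMean_le hn X hX hK h0 h1).trans ?_
    rw [Real.exp_add, ← hv]
    gcongr
  have hfin : ∀ E : ℝ, 0 ≤ E → E ≤ 1 → E * (1 + c * Real.exp c / (n : ℝ) ^ 2)
      ≤ c * Real.exp c / (n : ℝ) ^ 2 + E := by
    intro E hE0 hE1
    have : 0 ≤ c * Real.exp c / (n : ℝ) ^ 2 := by positivity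
    nlinarith
  -- the two cases are `q = 0` and `q > 0`
  rcases le_or_gt (v / 8 - max 0 (-Real.log S) / 2) 0 with hq | hq
  · have hpen : penalty S v = 0 := max_eq_left hq
    rw [hpen]
    calc ∫ B, min 1 (S * Real.exp (batchMean X B - v / 2)) ∂(batchLaw n N)
        ≤ ∫ B, S * Real.exp (-(v / 2)) * Real.exp (1 * batchMean X B) ∂(batchLaw n N) := by
          refine integral_mono Integrable.of_finite Integrable.of_finite fun B => ?_
          refine (min_le_right _ _).trans (le_of_eq ?_)
          rw [mul_assoc, ← Real.exp_add]; ring_nf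
      _ ≤ S * Real.exp (-(v / 2)) *
            (Real.exp (1 ^ 2 * v / 2) * (1 + c * Real.exp c / (n : ℝ) ^ 2)) := by
          rw [integral_const_mul]; gcongr; exact hbase 1 zero_le_one le_rfl
      _ = S * (1 * (1 + c * Real.exp c / (n : ℝ) ^ 2)) := by
          have : Real.exp (-(v / 2)) * Real.exp (1 ^ 2 * v / 2) = 1 := by
            rw [← Real.exp_add]; ring_nf; simp
          calc _ = S * ((Real.exp (-(v / 2)) * Real.exp (1 ^ 2 * v / 2)) *
              (1 + c * Real.exp c / (n : ℝ) ^ 2)) := by ring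
            _ = _ := by rw [this]
      _ ≤ _ := by
          have := hfin 1 zero_le_one le_rfl
          gcongr
          simpa using this
  · have hpen : penalty S v = v / 8 - max 0 (-Real.log S) / 2 := max_eq_right hq.le
    rw [hpen]
    set E := Real.exp (-(v / 8 - max 0 (-Real.log S) / 2)) with hE
    have hE1 : E ≤ 1 := Real.exp_le_one_iff.2 (by linarith)
    calc ∫ B, min 1 (S * Real.exp (batchMean X B - v / 2)) ∂(batchLaw n N)
        ≤ ∫ B, √S * Real.exp (-(v / 4)) * Real.exp (1 / 2 * batchMean X B)
            ∂(batchLaw n N) := by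
          refine integral_mono Integrable.of_finite Integrable.of_finite fun B => ?_
          refine (min_one_le_sqrt (by positivity)).trans (le_of_eq ?_)
          rw [Real.sqrt_mul hS.le, ← Real.exp_half, mul_assoc, ← Real.exp_add]; ring_nf
      _ ≤ √S * Real.exp (-(v / 4)) *
            (Real.exp ((1 / 2) ^ 2 * v / 2) * (1 + c * Real.exp c / (n : ℝ) ^ 2)) := by
          rw [integral_const_mul]; gcongr; exact hbase _ (by norm_num) (by norm_num)
      _ = √S * Real.exp (-(v / 8)) * (1 + c * Real.exp c / (n : ℝ) ^ 2) := by
          have : Real.exp (-(v / 4)) * Real.exp ((1 / 2) ^ 2 * v / 2) = Real.exp (-(v / 8)) := by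
            rw [← Real.exp_add]; ring_nf
          rw [← this]; ring
      _ ≤ S * E * (1 + c * Real.exp c / (n : ℝ) ^ 2) := by
          refine mul_le_mul_of_nonneg_right ?_ (by positivity)
          -- `√S ≤ S * exp (log⁻ S / 2)`, with equality if `S ≤ 1`
          have h1 : √S = Real.exp (Real.log S / 2) := by
            rw [Real.exp_half, Real.exp_log hS]
          have h2 : S = Real.exp (Real.log S) := (Real.exp_log hS).symm
          rw [h1, hE]
          nth_rw 2 [h2]
          rw [← Real.exp_add, ← Real.exp_add, Real.exp_le_exp]
          linarith [le_max_right 0 (-Real.log S)]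
      _ ≤ _ := by
          rw [mul_assoc]
          have := hfin E (Real.exp_pos _).le hE1
          gcongr

lemma penalty_nonneg (S v : ℝ) : 0 ≤ penalty S v := le_max_left _ _

/-- Jensen's inequality for the exponential function on a finite probability space. -/
lemma exp_integral_le {Ω : Type*} [MeasurableSpace Ω] [Finite Ω] [MeasurableSingletonClass Ω]
    (μ : Measure Ω) [IsProbabilityMeasure μ] (f : Ω → ℝ) :
    Real.exp (∫ ω, f ω ∂μ) ≤ ∫ ω, Real.exp (f ω) ∂μ :=
  convexOn_exp.map_integral_le Real.continuous_exp.continuousOn isClosed_univ (by simp)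
    Integrable.of_finite Integrable.of_finite

/-- The lower bound for the truncated rate: `min {1, S u} ≥ min {1, S} min {1, u}`, and the
expectation of `min {1, u}`, `log u = Z - v / 2`, is bounded from below by Jensen's inequality
and `E |Z| ≤ √v`. -/
lemma le_integral_min_one {n N : ℕ} [NeZero N] (hn : 1 ≤ n) (X : Fin N → ℝ)
    (hX : ∑ i, X i = 0) {S v A q : ℝ} (hS : 0 < S) (hA : 0 ≤ A) (hq : 0 ≤ q)
    (hv : v = Var[batchMean X; batchLaw n N]) :
    Real.exp (-(√v + v / 2 + A / (n : ℝ) ^ 2)) * min 1 (S * (A / (n : ℝ) ^ 2 + Real.exp (-q)))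
      ≤ ∫ B, min 1 (S * Real.exp (batchMean X B - v / 2)) ∂(batchLaw n N) := by
  have hv0 : 0 ≤ v := hv ▸ variance_nonneg _ _
  have hAn : 0 ≤ A / (n : ℝ) ^ 2 := by positivity
  have h1 : min 1 (S * (A / (n : ℝ) ^ 2 + Real.exp (-q)))
      ≤ Real.exp (A / (n : ℝ) ^ 2) * min 1 S := by
    rw [mul_min_of_nonneg _ _ (Real.exp_pos _).le]
    refine min_le_min ?_ ?_
    · simpa using hAn
    · rw [mul_comm]
      gcongr
      have h2 : Real.exp (-q) ≤ 1 := Real.exp_le_one_iff.2 (by linarith)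
      linarith [Real.add_one_le_exp (A / (n : ℝ) ^ 2)]
  have h2 : Real.exp (-(√v + v / 2)) ≤
      ∫ B, Real.exp (min 0 (batchMean X B - v / 2)) ∂(batchLaw n N) := by
    refine le_trans (Real.exp_le_exp.2 ?_) (exp_integral_le _ _)
    calc -(√v + v / 2) ≤ -∫ B, |batchMean X B| ∂(batchLaw n N) - v / 2 := by
          have := integral_abs_batchMean_le (n := n) X hX
          rw [← hv] at this
          linarith
      _ = ∫ B, (-|batchMean X B| - v / 2) ∂(batchLaw n N) := by
          rw [integral_sub Integrable.of_finite Integrable.of_finite, integral_neg]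
          simp
      _ ≤ _ := by
          refine integral_mono Integrable.of_finite Integrable.of_finite fun B => ?_
          refine le_min ?_ ?_
          · have := abs_nonneg (batchMean X B)
            linarith
          · linarith [neg_abs_le (batchMean X B)]
  calc _ ≤ Real.exp (-(√v + v / 2 + A / (n : ℝ) ^ 2))
          * (Real.exp (A / (n : ℝ) ^ 2) * min 1 S) := by gcongr
    _ = min 1 S * Real.exp (-(√v + v / 2)) := by
        rw [← mul_assoc, ← Real.exp_add, mul_comm]; ring_nf
    _ ≤ min 1 S * ∫ B, Real.exp (min 0 (batchMean X B - v / 2)) ∂(batchLaw n N) := by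
        gcongr
    _ ≤ _ := by
        rw [← integral_const_mul]
        refine integral_mono Integrable.of_finite Integrable.of_finite fun B => ?_
        have h3 : Real.exp (min 0 (batchMean X B - v / 2))
            ≤ Real.exp (batchMean X B - v / 2) := Real.exp_le_exp.2 (min_le_right _ _)
        have h4 : Real.exp (min 0 (batchMean X B - v / 2)) ≤ 1 :=
          Real.exp_le_one_iff.2 (min_le_left _ _)
        refine le_min ?_ ?_
        · exact mul_le_one₀ (min_le_left _ _) (Real.exp_pos _).le h4
        · exact mul_le_mul (min_le_right _ _) h3 (Real.exp_pos _).le hS.le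

variable {N d : ℕ}

/-! ### The logarithm of the stochastic swapping rate as a batch average -/

/-- The difference, over the two chains, of the control-variate corrections of data point `i`. -/
noncomputable def correction (L : Fin N → Param d → ℝ) (x y : Pair d) (i : Fin N) : ℝ :=
  (L i (x 0) - L i (y 0)) - (L i (x 1) - L i (y 1))

/-- The contribution of data point `i` to the fluctuation of the logarithm of the stochastic
swapping rate, centred under the uniform law on the data points. -/
noncomputable def swapNoise (L : Fin N → Param d → ℝ) (τ : Fin 2 → ℝ) (x y : Pair d)
    (i : Fin N) : ℝ :=
  invTempGap τ * (N * correction L x y i - ∑ k, correction L x y k)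

lemma sum_swapNoise (L : Fin N → Param d → ℝ) (τ : Fin 2 → ℝ) (x y : Pair d) :
    ∑ i, swapNoise L τ x y i = 0 := by
  simp [swapNoise, ← Finset.mul_sum]

lemma vrEnergy_sub_eq {n : ℕ} (hn : 1 ≤ n) (L : Fin N → Param d → ℝ) (τ : Fin 2 → ℝ)
    (x y : Pair d) (B : Fin n → Fin N) :
    invTempGap τ * (vrEnergy L B (x 0) (y 0) - vrEnergy L B (x 1) (y 1))
      = invTempGap τ * (energy L (x 0) - energy L (x 1)) + batchMean (swapNoise L τ x y) B := by
  have hn' : (n : ℝ) ≠ 0 := by positivity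
  have h1 : ∑ k, correction L x y k
      = (energy L (x 0) - energy L (y 0)) - (energy L (x 1) - energy L (y 1)) := by
    simp [correction, energy, Finset.sum_sub_distrib]
  have h2 : ∑ j, correction L x y (B j)
      = ∑ j, (L (B j) (x 0) - L (B j) (y 0)) - ∑ j, (L (B j) (x 1) - L (B j) (y 1)) := by
    simp [correction, Finset.sum_sub_distrib]
  have h3 : ∑ j, swapNoise L τ x y (B j) = invTempGap τ * (N * ∑ j, correction L x y (B j)
      - n * ∑ k, correction L x y k) := by
    simp [swapNoise, ← Finset.mul_sum, Finset.sum_sub_distrib]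
  rw [batchMean, h3, h1, h2]
  unfold vrEnergy
  field_simp
  ring

lemma logVariance_eq [NeZero N] {n : ℕ} (hn : 1 ≤ n) (L : Fin N → Param d → ℝ) (τ : Fin 2 → ℝ)
    (x y : Pair d) :
    logVariance L τ n x y = Var[batchMean (swapNoise L τ x y); batchLaw n N] := by
  unfold logVariance vrVariance
  rw [← variance_const_mul]
  simp_rw [vrEnergy_sub_eq hn]
  rw [variance_const_add (by fun_prop)]

lemma logVariance_nonneg (L : Fin N → Param d → ℝ) (τ : Fin 2 → ℝ) (n : ℕ) (x y : Pair d) :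
    0 ≤ logVariance L τ n x y :=
  mul_nonneg (sq_nonneg _) (variance_nonneg _ _)

lemma vrSwapRate_eq {n : ℕ} (hn : 1 ≤ n) (L : Fin N → Param d → ℝ) (τ : Fin 2 → ℝ)
    (x y : Pair d) (B : Fin n → Fin N) :
    vrSwapRate L τ B x y = swapRate L τ x *
      Real.exp (batchMean (swapNoise L τ x y) B - logVariance L τ n x y / 2) := by
  unfold vrSwapRate swapRate
  rw [mul_sub, vrEnergy_sub_eq hn, ← Real.exp_add]
  unfold logVariance
  ring_nf

lemma logVariance_le [NeZero N] {n : ℕ} (hn : 1 ≤ n) (L : Fin N → Param d → ℝ) (τ : Fin 2 → ℝ)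
    (x y : Pair d) {K : ℝ} (hK : ∀ i, |swapNoise L τ x y i| ≤ K) :
    logVariance L τ n x y ≤ K ^ 2 / n := by
  rw [logVariance_eq hn, variance_batchMean _ (sum_swapNoise L τ x y)]
  gcongr
  calc ∫ i, swapNoise L τ x y i ^ 2 ∂(uniformOn Set.univ)
      ≤ ∫ _, K ^ 2 ∂(uniformOn Set.univ : Measure (Fin N)) := by
        refine integral_mono Integrable.of_finite Integrable.of_finite fun i => ?_
        exact sq_le_sq' (abs_le.1 (hK i)).1 (abs_le.1 (hK i)).2
    _ = K ^ 2 := by simp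

lemma abs_swapNoise_le (L : Fin N → Param d → ℝ) (τ : Fin 2 → ℝ) (x y : Pair d) {κ : ℝ}
    (hκ : ∀ i, |correction L x y i| ≤ κ) (i : Fin N) :
    |swapNoise L τ x y i| ≤ 2 * N * |invTempGap τ| * κ := by
  have h1 : |∑ k, correction L x y k| ≤ N * κ :=
    (Finset.abs_sum_le_sum_abs _ _).trans ((Finset.sum_le_sum fun k _ => hκ k).trans (by simp))
  have h2 : |(N : ℝ) * correction L x y i| ≤ N * κ := by
    rw [abs_mul, Nat.abs_cast]
    gcongr
    exact hκ i
  rw [swapNoise, abs_mul]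
  have h3 := abs_sub ((N : ℝ) * correction L x y i) (∑ k, correction L x y k)
  calc _ ≤ |invTempGap τ| * (N * κ + N * κ) := by gcongr; linarith
    _ = _ := by ring

/-! ### Control of the fluctuation by the distance from the snapshot -/

lemma SmoothDissipative.exists_norm_gradient_le {L : Fin N → Param d → ℝ} {CN a b : ℝ}
    (hL : SmoothDissipative L CN a b) :
    ∃ G : ℝ, 0 ≤ G ∧ ∀ i x, ‖∇ (L i) x‖ ≤ CN * ‖x‖ + G := by
  refine ⟨∑ i, ‖∇ (L i) 0‖, by positivity, fun i x => ?_⟩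
  have h1 := hL.smooth i x 0
  have h2 : ‖∇ (L i) 0‖ ≤ ∑ i, ‖∇ (L i) 0‖ :=
    Finset.single_le_sum (f := fun i => ‖∇ (L i) 0‖) (fun _ _ => norm_nonneg _)
      (Finset.mem_univ i)
  have h3 := norm_sub_norm_le (∇ (L i) x) (∇ (L i) 0)
  rw [sub_zero] at h1
  linarith

lemma SmoothDissipative.abs_sub_le {L : Fin N → Param d → ℝ} {CN a b G : ℝ}
    (hL : SmoothDissipative L CN a b) (hG : ∀ i x, ‖∇ (L i) x‖ ≤ CN * ‖x‖ + G) {R : ℝ}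
    (i : Fin N) {x y : Param d} (hx : ‖x‖ ≤ R) (hy : ‖y‖ ≤ R) :
    |L i x - L i y| ≤ (CN * R + G) * ‖x - y‖ := by
  have h := (convex_closedBall (0 : Param d) R).norm_image_sub_le_of_norm_fderiv_le (𝕜 := ℝ)
    (f := L i) (C := CN * R + G) (x := y) (y := x) (fun z _ => hL.differentiable i z)
    (fun z hz => ?_) (by simpa using hy) (by simpa using hx)
  · simpa using h
  · rw [← toDual_gradient, LinearIsometryEquiv.norm_map]
    have hz' : ‖z‖ ≤ R := by simpa using hz
    refine (hG i z).trans ?_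
    have := hL.CN_pos
    gcongr

lemma SmoothDissipative.abs_correction_le {L : Fin N → Param d → ℝ} {CN a b G : ℝ}
    (hL : SmoothDissipative L CN a b) (hG : ∀ i x, ‖∇ (L i) x‖ ≤ CN * ‖x‖ + G) {R : ℝ}
    {x y : Pair d} (hxy : ∀ h, ‖x h‖ ≤ R ∧ ‖y h‖ ≤ R) (i : Fin N) :
    |correction L x y i| ≤ (CN * R + G) * ∑ h, ‖x h - y h‖ := by
  have h0 := hL.abs_sub_le hG i (hxy 0).1 (hxy 0).2
  have h1 := hL.abs_sub_le hG i (hxy 1).1 (hxy 1).2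
  have h2 := abs_sub (L i (x 0) - L i (y 0)) (L i (x 1) - L i (y 1))
  rw [Fin.sum_univ_two, mul_add]
  unfold correction
  linarith

/-- The log-variance is controlled by the distance of the parameters from their snapshots. -/
lemma SmoothDissipative.logVariance_le_dist [NeZero N] {L : Fin N → Param d → ℝ} {CN a b G : ℝ}
    (hL : SmoothDissipative L CN a b) (hG : ∀ i x, ‖∇ (L i) x‖ ≤ CN * ‖x‖ + G) (τ : Fin 2 → ℝ)
    {R : ℝ} {n : ℕ} (hn : 1 ≤ n) {x y : Pair d} (hxy : ∀ h, ‖x h‖ ≤ R ∧ ‖y h‖ ≤ R) :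
    logVariance L τ n x y ≤
      2 * (2 * N * |invTempGap τ| * (CN * R + G)) ^ 2 / n * ∑ h, ‖x h - y h‖ ^ 2 := by
  refine (logVariance_le hn L τ x y
    (abs_swapNoise_le L τ x y (hL.abs_correction_le hG hxy))).trans ?_
  have h1 : (∑ h, ‖x h - y h‖) ^ 2 ≤ 2 * ∑ h, ‖x h - y h‖ ^ 2 := by
    simpa using sq_sum_le_card_mul_sum_sq (s := Finset.univ) (f := fun h => ‖x h - y h‖)
  calc _ = (2 * N * |invTempGap τ| * (CN * R + G)) ^ 2 / n * (∑ h, ‖x h - y h‖) ^ 2 := by ring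
    _ ≤ (2 * N * |invTempGap τ| * (CN * R + G)) ^ 2 / n * (2 * ∑ h, ‖x h - y h‖ ^ 2) := by
        gcongr
    _ = _ := by ring

lemma approxRate_nonneg (L : Fin N → Param d → ℝ) (τ : Fin 2 → ℝ) {A : ℝ} (hA : 0 ≤ A) (n : ℕ)
    (x y : Pair d) : 0 ≤ approxRate L τ A n x y := by
  unfold approxRate
  have : 0 < swapRate L τ x := Real.exp_pos _
  positivity

/-- The two-sided approximation of the expected truncated swapping rate on a ball. -/
theorem SmoothDissipative.exists_approxRate_bounds [NeZero N] {L : Fin N → Param d → ℝ}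
    {CN a b : ℝ} (hL : SmoothDissipative L CN a b) (τ : Fin 2 → ℝ) (R : ℝ) :
    ∃ A C : ℝ, 0 < A ∧ 0 < C ∧
      ∀ n : ℕ, 1 ≤ n → ∀ x y : Pair d, (∀ h, ‖x h‖ ≤ R ∧ ‖y h‖ ≤ R) →
        logVariance L τ n x y ≤ C / n ∧
        expTruncSwapRate L τ n x y ≤ approxRate L τ A n x y ∧
        Real.exp (-(C * (√(logVariance L τ n x y) + 1 / (n : ℝ) ^ 2))) * approxRate L τ A n x y
          ≤ expTruncSwapRate L τ n x y := by
  obtain ⟨G, hG0, hG⟩ := hL.exists_norm_gradient_le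
  have hCN := hL.CN_pos
  set K : ℝ := 2 * N * |invTempGap τ| * ((CN * |R| + G) * (4 * |R|)) + 1 with hKdef
  have hK0 : 0 < K := by positivity
  set A : ℝ := K ^ 3 * Real.exp K * Real.exp (K ^ 3 * Real.exp K) with hA
  have hA0 : 0 < A := by positivity
  refine ⟨A, K ^ 2 + K + 1 + A, hA0, by positivity, fun n hn x y hxy => ?_⟩
  have hn' : (1 : ℝ) ≤ n := by exact_mod_cast hn
  have hR : 0 ≤ R := (norm_nonneg _).trans (hxy 0).1
  have hK : ∀ i, |swapNoise L τ x y i| ≤ K := by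
    intro i
    refine (abs_swapNoise_le L τ x y (hL.abs_correction_le hG hxy) i).trans ?_
    have h1 : ∑ h, ‖x h - y h‖ ≤ 4 * R := by
      rw [Fin.sum_univ_two]
      linarith [norm_sub_le (x 0) (y 0), norm_sub_le (x 1) (y 1), (hxy 0).1, (hxy 0).2,
        (hxy 1).1, (hxy 1).2]
    have h2 : 2 * N * |invTempGap τ| * ((CN * R + G) * ∑ h, ‖x h - y h‖)
        ≤ 2 * N * |invTempGap τ| * ((CN * R + G) * (4 * R)) := by gcongr
    rw [hKdef, abs_of_nonneg hR]
    linarith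
  have hv := logVariance_le hn L τ x y hK
  have hve := logVariance_eq hn L τ x y
  have hX := sum_swapNoise L τ x y
  have hS : 0 < swapRate L τ x := Real.exp_pos _
  have hE : expTruncSwapRate L τ n x y = ∫ B, min 1 (swapRate L τ x *
      Real.exp (batchMean (swapNoise L τ x y) B - logVariance L τ n x y / 2))
      ∂(batchLaw n N) := by
    unfold expTruncSwapRate
    simp_rw [vrSwapRate_eq hn]
  refine ⟨hv.trans (by gcongr; linarith), ?_, ?_⟩
  · rw [hE]
    exact integral_min_one_le hn _ hX hK hS hve
  · rw [hE]
    refine le_trans ?_ (le_integral_min_one hn _ hX hS hA0.le 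
      (penalty_nonneg (swapRate L τ x) (logVariance L τ n x y)) hve)
    set v := logVariance L τ n x y with hvdef
    have hv0 : 0 ≤ v := logVariance_nonneg L τ n x y
    refine mul_le_mul_of_nonneg_right ?_ (approxRate_nonneg L τ hA0.le n x y)
    rw [Real.exp_le_exp, neg_le_neg_iff]
    have h1 : √v ≤ K := by
      rw [Real.sqrt_le_left hK0.le]
      exact hv.trans (div_le_self (by positivity) hn')
    have h2 : v = √v * √v := (Real.mul_self_sqrt hv0).symm
    have h3 : v ≤ K * √v := by
      nth_rw 1 [h2]
      gcongr
    have h4 : 0 ≤ √v := Real.sqrt_nonneg v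
    have h5 : 0 ≤ 1 / (n : ℝ) ^ 2 := by positivity
    have h6 : A / (n : ℝ) ^ 2 = A * (1 / (n : ℝ) ^ 2) := by ring
    rw [h6]
    generalize 1 / (n : ℝ) ^ 2 = w at *
    nlinarith [mul_nonneg hA0.le h4, mul_nonneg (sq_nonneg K) h4, mul_nonneg (sq_nonneg K) h5,
      mul_nonneg hK0.le h5]

lemma SmoothDissipative.measurable_vrSwapRate [NeZero N] {L : Fin N → Param d → ℝ} {CN a b : ℝ}
    (hL : SmoothDissipative L CN a b) (τ : Fin 2 → ℝ) {n : ℕ} (hn : 1 ≤ n) :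
    Measurable fun p : (Fin n → Fin N) × Pair d × Pair d => vrSwapRate L τ p.1 p.2.1 p.2.2 := by
  have hc : ∀ i, Continuous (L i) := fun i => (hL.differentiable i).continuous
  refine measurable_from_prod_countable_right fun B => Continuous.measurable ?_
  simp_rw [vrSwapRate_eq hn, logVariance_eq hn, variance_batchMean _ (sum_swapNoise L τ _ _),
    integral_uniformOn_univ, batchMean, swapNoise, correction, swapRate, energy]
  fun_prop

/-! ### The noise of one iteration -/

instance isProbabilityMeasure_noiseLaw (n N d : ℕ) [NeZero N] :
    IsProbabilityMeasure (noiseLaw n N d) := by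
  have : IsProbabilityMeasure (volume.restrict (Set.Icc (0 : ℝ) 1)) := ⟨by simp⟩
  unfold noiseLaw
  infer_instance

lemma measurePreserving_batch_gaussian (n N d : ℕ) [NeZero N] (h : Fin 2) :
    MeasurePreserving (fun z : Noise n N d => (z.1, z.2.1 h)) (noiseLaw n N d)
      ((batchLaw n N).prod (stdGaussian (Param d))) := by
  have : IsProbabilityMeasure (volume.restrict (Set.Icc (0 : ℝ) 1)) := ⟨by simp⟩
  exact (MeasurePreserving.id _).prod
    ((measurePreserving_eval (fun _ : Fin 2 => stdGaussian (Param d)) h).comp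
      measurePreserving_fst)

/-- The part of the noise which drives the Langevin step is independent of the uniform variable
which decides about the swap. -/
lemma lintegral_mul_indicator_uniform_le (n N d : ℕ) [NeZero N]
    {F : (Fin n → Fin N) × (Fin 2 → Param d) → ENNReal} (hF : Measurable F) (s : ℝ) :
    ∫⁻ z : Noise n N d, F (z.1, z.2.1) * (Set.Iio s).indicator 1 z.2.2 ∂(noiseLaw n N d)
      ≤ ENNReal.ofReal s * ∫⁻ z : Noise n N d, F (z.1, z.2.1) ∂(noiseLaw n N d) := by
  have : IsProbabilityMeasure (volume.restrict (Set.Icc (0 : ℝ) 1)) := ⟨by simp⟩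
  have hp := measurePreserving_prodAssoc (batchLaw n N)
    (Measure.pi fun _ : Fin 2 => stdGaussian (Param d)) (volume.restrict (Set.Icc (0 : ℝ) 1))
  have hm : Measurable ((Set.Iio s).indicator (1 : ℝ → ENNReal)) :=
    measurable_one.indicator measurableSet_Iio
  have e1 : ∫⁻ z : Noise n N d, F (z.1, z.2.1) * (Set.Iio s).indicator 1 z.2.2 ∂(noiseLaw n N d)
      = ∫⁻ q, F q.1 * (Set.Iio s).indicator 1 q.2 ∂(((batchLaw n N).prod
        (Measure.pi fun _ : Fin 2 => stdGaussian (Param d))).prod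
          (volume.restrict (Set.Icc (0 : ℝ) 1))) :=
    (hp.lintegral_comp (by fun_prop)).symm
  have e2 : ∫⁻ z : Noise n N d, F (z.1, z.2.1) ∂(noiseLaw n N d)
      = ∫⁻ q, F q ∂((batchLaw n N).prod
        (Measure.pi fun _ : Fin 2 => stdGaussian (Param d))) := by
    refine (hp.lintegral_comp (f := fun z => F (z.1, z.2.1)) (by fun_prop)).symm.trans ?_
    exact measurePreserving_fst.lintegral_comp hF
  rw [e1, e2, lintegral_prod_mul (f := F) hF.aemeasurable hm.aemeasurable]
  rw [mul_comm]
  gcongr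
  rw [lintegral_indicator_one measurableSet_Iio, Measure.restrict_apply measurableSet_Iio]
  calc _ ≤ volume (Set.Icc 0 s) := measure_mono fun u hu => ⟨hu.2.1, hu.1.le⟩
    _ = _ := by simp

/-- The second moment of a standard Gaussian vector. -/
noncomputable def gaussianMoment (d : ℕ) : ℝ := ∫ ξ : Param d, ‖ξ‖ ^ 2 ∂(stdGaussian (Param d))

lemma gaussianMoment_nonneg (d : ℕ) : 0 ≤ gaussianMoment d :=
  integral_nonneg fun _ => by positivity

lemma lintegral_norm_add_gaussian (u : Param d) (c : ℝ) :
    ∫⁻ ξ, ENNReal.ofReal (‖u + c • ξ‖ ^ 2) ∂(stdGaussian (Param d))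
      = ENNReal.ofReal (‖u‖ ^ 2 + c ^ 2 * gaussianMoment d) := by
  have h2 : MemLp id 2 (stdGaussian (Param d)) := IsGaussian.memLp_two_id
  have hi1 : Integrable (fun ξ : Param d => ξ) (stdGaussian (Param d)) :=
    h2.integrable one_le_two
  have hi2 : Integrable (fun ξ : Param d => ‖ξ‖ ^ 2) (stdGaussian (Param d)) :=
    h2.integrable_norm_pow two_ne_zero
  have hinner : Integrable (fun ξ : Param d => 2 * (c * inner ℝ u ξ)) (stdGaussian (Param d)) :=
    ((hi1.const_inner u).const_mul c).const_mul 2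
  have hexp : ∀ ξ : Param d,
      ‖u + c • ξ‖ ^ 2 = ‖u‖ ^ 2 + 2 * (c * inner ℝ u ξ) + c ^ 2 * ‖ξ‖ ^ 2 := by
    intro ξ
    rw [norm_add_sq_real, inner_smul_right, norm_smul, mul_pow, Real.norm_eq_abs, sq_abs]
  simp_rw [hexp]
  rw [← ofReal_integral_eq_lintegral_ofReal]
  · congr 1
    rw [integral_add (f := fun ξ : Param d => ‖u‖ ^ 2 + 2 * (c * inner ℝ u ξ))
      ((integrable_const _).add hinner) (hi2.const_mul _),
      integral_add (integrable_const _) hinner, integral_const_mul, integral_const_mul,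
      integral_const_mul, integral_inner hi1, integral_id_stdGaussian]
    simp [gaussianMoment]
  · exact ((integrable_const _).add hinner).add (hi2.const_mul _)
  · exact Filter.Eventually.of_forall fun ξ => by
      simp only [Pi.zero_apply]
      rw [← hexp]; positivity

lemma lintegral_norm_add_noise {n : ℕ} [NeZero N] (w : (Fin n → Fin N) → Param d) (c : ℝ)
    (h : Fin 2) :
    ∫⁻ z, ENNReal.ofReal (‖w z.1 + c • z.2.1 h‖ ^ 2) ∂(noiseLaw n N d)
      = ENNReal.ofReal (∫ B, ‖w B‖ ^ 2 ∂(batchLaw n N) + c ^ 2 * gaussianMoment d) := by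
  have hw : Measurable w := .of_discrete
  have hm : Measurable fun q : (Fin n → Fin N) × Param d =>
      ENNReal.ofReal (‖w q.1 + c • q.2‖ ^ 2) := by fun_prop
  rw [(measurePreserving_batch_gaussian n N d h).lintegral_comp hm,
    lintegral_prod _ hm.aemeasurable]
  simp only [lintegral_norm_add_gaussian]
  have hD := gaussianMoment_nonneg d
  rw [← ofReal_integral_eq_lintegral_ofReal Integrable.of_finite
    (Filter.Eventually.of_forall fun B => by positivity),
    integral_add Integrable.of_finite Integrable.of_finite]
  simp

/-! ### The mini-batch gradient -/

lemma gradient_energy {L : Fin N → Param d → ℝ} (hL : ∀ i, Differentiable ℝ (L i))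
    (x : Param d) : ∇ (energy L) x = ∑ i, ∇ (L i) x := by
  apply HasGradientAt.gradient
  rw [hasGradientAt_iff_hasFDerivAt, map_sum]
  unfold energy
  refine HasFDerivAt.fun_sum fun i _ => ?_
  exact (hL i x).hasGradientAt.hasFDerivAt

lemma integral_batchGradient {n : ℕ} [NeZero N] (hn : 1 ≤ n) {L : Fin N → Param d → ℝ}
    (hL : ∀ i, Differentiable ℝ (L i)) (x : Param d) :
    ∫ B : Fin n → Fin N, batchGradient L B x ∂(batchLaw n N) = ∇ (energy L) x := by
  have hn' : (n : ℝ) ≠ 0 := by positivity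
  have hN' : (N : ℝ) ≠ 0 := by exact_mod_cast NeZero.ne N
  unfold batchGradient batchLaw
  rw [integral_smul, integral_finsetSum _ fun _ _ => Integrable.of_finite]
  simp_rw [integral_comp_eval (μ := fun _ : Fin n => (uniformOn Set.univ : Measure (Fin N)))
    (f := fun i => ∇ (L i) x) (Measurable.of_discrete.aestronglyMeasurable),
    integral_uniformOn_univ]
  rw [gradient_energy hL, Finset.sum_const, Finset.card_univ, Fintype.card_fin,
    ← Nat.cast_smul_eq_nsmul ℝ, smul_smul, smul_smul]
  have : (N : ℝ) / n * (n * (N : ℝ)⁻¹) = 1 := by field_simp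
  rw [← mul_assoc] at this
  rw [this, one_smul]

lemma norm_batchGradient_le {n : ℕ} (hn : 1 ≤ n) {L : Fin N → Param d → ℝ} {CN G : ℝ}
    (hG : ∀ i x, ‖∇ (L i) x‖ ≤ CN * ‖x‖ + G) (B : Fin n → Fin N) (x : Param d) :
    ‖batchGradient L B x‖ ≤ N * (CN * ‖x‖ + G) := by
  have hn' : (n : ℝ) ≠ 0 := by positivity
  rw [batchGradient, norm_smul, Real.norm_of_nonneg (by positivity)]
  calc (N : ℝ) / n * ‖∑ j, ∇ (L (B j)) x‖ ≤ N / n * (n * (CN * ‖x‖ + G)) := by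
        gcongr
        refine (norm_sum_le _ _).trans ((Finset.sum_le_sum fun j _ => hG (B j) x).trans ?_)
        simp [mul_add]
    _ = _ := by field_simp

/-- The step-size restriction makes the squared mini-batch gradient absorbable by dissipativity:
it costs `3 / 2` of the available `2 a`. -/
lemma sq_norm_batchGradient_le {n : ℕ} (hn : 1 ≤ n) {L : Fin N → Param d → ℝ} {CN G a η : ℝ}
    (hG : ∀ i x, ‖∇ (L i) x‖ ≤ CN * ‖x‖ + G) (hη0 : 0 ≤ η) (hη1 : η ≤ 1)
    (hη : η * (N * CN) ^ 2 ≤ a) (B : Fin n → Fin N) (x : Param d) :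
    η ^ 2 * ‖batchGradient L B x‖ ^ 2 ≤ η * (3 / 2 * a * ‖x‖ ^ 2 + 3 * (N * G) ^ 2) := by
  have h1 : ‖batchGradient L B x‖ ^ 2 ≤ (N * (CN * ‖x‖ + G)) ^ 2 := by
    gcongr
    exact norm_batchGradient_le hn hG B x
  have h2 : (N * (CN * ‖x‖ + G)) ^ 2 ≤ 3 / 2 * (N * CN) ^ 2 * ‖x‖ ^ 2 + 3 * (N * G) ^ 2 := by
    -- `2 u w ≤ u² / 2 + 2 w²`
    nlinarith [sq_nonneg (N * CN * ‖x‖ - 2 * (N * G))]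
  calc η ^ 2 * ‖batchGradient L B x‖ ^ 2
      ≤ η ^ 2 * (3 / 2 * (N * CN) ^ 2 * ‖x‖ ^ 2 + 3 * (N * G) ^ 2) := by
        gcongr; exact h1.trans h2
    _ = η * (3 / 2 * (η * (N * CN) ^ 2) * ‖x‖ ^ 2 + η * (3 * (N * G) ^ 2)) := by ring
    _ ≤ η * (3 / 2 * a * ‖x‖ ^ 2 + 1 * (3 * (N * G) ^ 2)) := by gcongr
    _ = _ := by ring

/-! ### One Langevin step -/

/-- The Langevin step of both chains, as a function of the starting pair and the noise. -/
noncomputable def langevinStep {n : ℕ} (L : Fin N → Param d → ℝ) (τ : Fin 2 → ℝ) (η : ℝ)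
    (p : Pair d) (z : Noise n N d) : Pair d := fun h =>
  p h - η • batchGradient L z.1 (p h) + √(2 * η * τ h) • z.2.1 h

/-- The sum over the two chains of the squared norms. It is invariant under swaps. -/
noncomputable def sqNorm (p : Pair d) : ℝ := ∑ h, ‖p h‖ ^ 2

lemma sqNorm_nonneg (p : Pair d) : 0 ≤ sqNorm p := by unfold sqNorm; positivity

lemma sqNorm_add_le (p q : Pair d) : sqNorm (p + q) ≤ 2 * sqNorm p + 2 * sqNorm q := by
  unfold sqNorm
  rw [Finset.mul_sum, Finset.mul_sum, ← Finset.sum_add_distrib]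
  refine Finset.sum_le_sum fun h _ => ?_
  have h1 : ‖(p + q) h‖ ≤ ‖p h‖ + ‖q h‖ := norm_add_le _ _
  nlinarith [norm_nonneg ((p + q) h), sq_nonneg (‖p h‖ - ‖q h‖)]

lemma sqNorm_rev (p : Pair d) : sqNorm (fun h => p h.rev) = sqNorm p := by
  simp [sqNorm, Fin.sum_univ_two, add_comm]

lemma sqNorm_rev_sub_le (p : Pair d) : sqNorm ((fun h => p h.rev) - p) ≤ 4 * sqNorm p := by
  have h := sqNorm_add_le (fun h => p h.rev) (-p)
  have h2 : sqNorm (-p) = sqNorm p := by simp [sqNorm]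
  rw [← sub_eq_add_neg, sqNorm_rev, h2] at h
  linarith

@[fun_prop]
lemma measurable_sqNorm : Measurable (sqNorm (d := d)) := by unfold sqNorm; fun_prop

/-- The bound for the additive second-moment growth per unit of learning rate in one step; `G` is
the constant in the linear growth bound `CN ‖x‖ + G` for the gradients. -/
noncomputable def growthConst (N d : ℕ) (G b : ℝ) (τ : Fin 2 → ℝ) : ℝ :=
  ∑ h, (2 * b + 3 * (N * G) ^ 2 + 2 * τ h * gaussianMoment d)

/-- The driving Gaussian vectors are centred and independent of the mini-batch, so that second
moments add up. -/
lemma lintegral_sqNorm_add_noise {n : ℕ} [NeZero N] (w : Fin 2 → (Fin n → Fin N) → Param d)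
    {τ : Fin 2 → ℝ} (hτ : ∀ h, 0 < τ h) {η : ℝ} (hη : 0 < η) :
    ∫⁻ z, ENNReal.ofReal (sqNorm fun h => w h z.1 + √(2 * η * τ h) • z.2.1 h) ∂(noiseLaw n N d)
      = ENNReal.ofReal (∑ h, (∫ B, ‖w h B‖ ^ 2 ∂(batchLaw n N)
          + 2 * η * τ h * gaussianMoment d)) := by
  have hD := gaussianMoment_nonneg d
  have hw : ∀ h, Measurable (w h) := fun h => .of_discrete
  simp_rw [sqNorm, ENNReal.ofReal_sum_of_nonneg fun h _ => sq_nonneg _]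
  rw [lintegral_finsetSum _ fun h _ => by fun_prop, ENNReal.ofReal_sum_of_nonneg fun h _ => ?_]
  · refine Finset.sum_congr rfl fun h _ => ?_
    rw [lintegral_norm_add_noise, Real.sq_sqrt (by have := hτ h; positivity)]
  · have := hτ h
    positivity

/-- The drift condition: one Langevin step contracts the second moment, up to a constant. -/
lemma SmoothDissipative.lintegral_sqNorm_langevinStep_le [NeZero N] {n : ℕ} (hn : 1 ≤ n)
    {L : Fin N → Param d → ℝ} {CN a b G η : ℝ} (hL : SmoothDissipative L CN a b)
    (hG : ∀ i x, ‖∇ (L i) x‖ ≤ CN * ‖x‖ + G) {τ : Fin 2 → ℝ} (hτ : ∀ h, 0 < τ h)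
    (hη0 : 0 < η) (hη1 : η ≤ 1) (hη : η * (N * CN) ^ 2 ≤ a) (p : Pair d) :
    ∫⁻ z : Noise n N d, ENNReal.ofReal (sqNorm (langevinStep L τ η p z)) ∂(noiseLaw n N d)
      ≤ ENNReal.ofReal ((1 - η * a / 2) * sqNorm p + η * growthConst N d G b τ) := by
  have hchain : ∀ x : Param d, ∫ B : Fin n → Fin N, ‖x - η • batchGradient L B x‖ ^ 2
      ∂(batchLaw n N) ≤ (1 - η * a / 2) * ‖x‖ ^ 2 + η * (2 * b + 3 * (N * G) ^ 2) := by
    intro x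
    have hexp : ∀ B : Fin n → Fin N, ‖x - η • batchGradient L B x‖ ^ 2
        ≤ ‖x‖ ^ 2 - 2 * η * inner ℝ x (batchGradient L B x)
          + η * (3 / 2 * a * ‖x‖ ^ 2 + 3 * (N * G) ^ 2) := by
      intro B
      have := sq_norm_batchGradient_le hn hG hη0.le hη1 hη B x
      rw [norm_sub_sq_real, inner_smul_right, norm_smul, mul_pow, Real.norm_eq_abs, sq_abs]
      linarith
    calc _ ≤ ∫ B : Fin n → Fin N, (‖x‖ ^ 2 - 2 * η * inner ℝ x (batchGradient L B x)
          + η * (3 / 2 * a * ‖x‖ ^ 2 + 3 * (N * G) ^ 2)) ∂(batchLaw n N) :=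
          integral_mono Integrable.of_finite Integrable.of_finite hexp
      _ = ‖x‖ ^ 2 - 2 * η * inner ℝ x (∇ (energy L) x)
          + η * (3 / 2 * a * ‖x‖ ^ 2 + 3 * (N * G) ^ 2) := by
          rw [integral_add Integrable.of_finite Integrable.of_finite,
            integral_sub Integrable.of_finite Integrable.of_finite, integral_const_mul,
            integral_inner Integrable.of_finite, integral_batchGradient hn hL.differentiable]
          simp
      _ ≤ _ := by
          have := mul_le_mul_of_nonneg_left (hL.dissipative x) hη0.le
          nlinarith
  refine (lintegral_sqNorm_add_noise (fun h B => p h - η • batchGradient L B (p h)) hτ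
    hη0).le.trans (ENNReal.ofReal_le_ofReal ?_)
  unfold sqNorm growthConst
  rw [Finset.mul_sum, Finset.mul_sum, ← Finset.sum_add_distrib]
  refine Finset.sum_le_sum fun h _ => ?_
  linarith [hchain (p h)]

/-- The expected squared displacement in one Langevin step is of the order of the learning
rate. -/
lemma lintegral_sqNorm_langevinStep_sub_le [NeZero N] {n : ℕ} (hn : 1 ≤ n)
    {L : Fin N → Param d → ℝ} {CN a b G η : ℝ} (hb : 0 ≤ b)
    (hG : ∀ i x, ‖∇ (L i) x‖ ≤ CN * ‖x‖ + G) {τ : Fin 2 → ℝ} (hτ : ∀ h, 0 < τ h)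
    (hη0 : 0 < η) (hη1 : η ≤ 1) (hη : η * (N * CN) ^ 2 ≤ a) (p : Pair d) :
    ∫⁻ z : Noise n N d, ENNReal.ofReal (sqNorm (langevinStep L τ η p z - p)) ∂(noiseLaw n N d)
      ≤ ENNReal.ofReal (η * (3 / 2 * a * sqNorm p + growthConst N d G b τ)) := by
  have hchain : ∀ x : Param d, ∫ B : Fin n → Fin N, ‖-(η • batchGradient L B x)‖ ^ 2
      ∂(batchLaw n N) ≤ η * (3 / 2 * a * ‖x‖ ^ 2 + 3 * (N * G) ^ 2) := by
    intro x
    calc _ ≤ ∫ _ : Fin n → Fin N, η * (3 / 2 * a * ‖x‖ ^ 2 + 3 * (N * G) ^ 2)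
          ∂(batchLaw n N) := by
          refine integral_mono Integrable.of_finite Integrable.of_finite fun B => ?_
          have := sq_norm_batchGradient_le hn hG hη0.le hη1 hη B x
          rw [norm_neg, norm_smul, mul_pow, Real.norm_eq_abs, sq_abs]
          exact this
      _ = _ := by simp
  have heq : ∀ z : Noise n N d, langevinStep L τ η p z - p
      = fun h => -(η • batchGradient L z.1 (p h)) + √(2 * η * τ h) • z.2.1 h := by
    intro z
    ext1 h
    simp only [langevinStep, Pi.sub_apply]
    abel
  simp_rw [heq]
  refine (lintegral_sqNorm_add_noise (fun h B => -(η • batchGradient L B (p h))) hτ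
    hη0).le.trans (ENNReal.ofReal_le_ofReal ?_)
  unfold sqNorm growthConst
  rw [Finset.mul_sum, ← Finset.sum_add_distrib, Finset.mul_sum]
  refine Finset.sum_le_sum fun h _ => ?_
  nlinarith [hchain (p h), mul_nonneg hη0.le hb]

/-! ### Independence -/

lemma indepFun_prodMk_left_of_indepFun {Ω α β γ : Type*} [MeasurableSpace Ω] {P : Measure Ω}
    [IsProbabilityMeasure P] [MeasurableSpace α] [MeasurableSpace β] [MeasurableSpace γ]
    {X : Ω → α} {U : Ω → β} {V : Ω → γ} (hX : Measurable X) (hU : Measurable U)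
    (hV : Measurable V) (h1 : IndepFun X (fun ω => (U ω, V ω)) P) (h2 : IndepFun U V P) :
    IndepFun (fun ω => (X ω, U ω)) V P := by
  have := Measure.isProbabilityMeasure_map (μ := P) hX.aemeasurable
  have := Measure.isProbabilityMeasure_map (μ := P) hU.aemeasurable
  have := Measure.isProbabilityMeasure_map (μ := P) hV.aemeasurable
  have h3 : IndepFun X U P := h1.comp (φ := id) (ψ := Prod.fst) measurable_id measurable_fst
  rw [indepFun_iff_map_prod_eq_prod_map_map hX.aemeasurable (by fun_prop)] at h1
  rw [indepFun_iff_map_prod_eq_prod_map_map hU.aemeasurable hV.aemeasurable] at h2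
  rw [indepFun_iff_map_prod_eq_prod_map_map hX.aemeasurable hU.aemeasurable] at h3
  rw [indepFun_iff_map_prod_eq_prod_map_map (by fun_prop) hV.aemeasurable, h3]
  have hp := measurePreserving_prodAssoc (P.map X) (P.map U) (P.map V)
  rw [← hp.symm.map_eq, ← h2, ← h1, Measure.map_map (by fun_prop) (by fun_prop)]
  rfl

lemma lintegral_comp_of_indepFun {Ω α β : Type*} [MeasurableSpace Ω] {P : Measure Ω}
    [IsProbabilityMeasure P] [MeasurableSpace α] [MeasurableSpace β] {X : Ω → α} {Y : Ω → β}
    (hX : Measurable X) (hY : Measurable Y) (h : IndepFun X Y P) {F : α × β → ENNReal}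
    (hF : Measurable F) :
    ∫⁻ ω, F (X ω, Y ω) ∂P = ∫⁻ ω, ∫⁻ y, F (X ω, y) ∂(P.map Y) ∂P := by
  have := Measure.isProbabilityMeasure_map (μ := P) hX.aemeasurable
  have := Measure.isProbabilityMeasure_map (μ := P) hY.aemeasurable
  rw [indepFun_iff_map_prod_eq_prod_map_map hX.aemeasurable hY.aemeasurable] at h
  rw [← lintegral_map hF (hX.prodMk hY), h, lintegral_prod _ hF.aemeasurable,
    lintegral_map hF.lintegral_prod_right' hX]

/-! ### Measurability of the Langevin and swap steps -/

lemma SmoothDissipative.measurable_langevinStep {L : Fin N → Param d → ℝ} {CN a b : ℝ}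
    (hL : SmoothDissipative L CN a b) (τ : Fin 2 → ℝ) (η : ℝ) (n : ℕ) :
    Measurable fun q : Pair d × Noise n N d => langevinStep L τ η q.1 q.2 := by
  have hc : ∀ i, Continuous (∇ (L i)) := fun i => by
    refine (LipschitzWith.of_dist_le_mul (K := ⟨CN, hL.CN_pos.le⟩) fun x y => ?_).continuous
    rw [dist_eq_norm, dist_eq_norm]
    exact hL.smooth i x y
  have h1 : Measurable fun q : (Fin n → Fin N) × Param d => batchGradient L q.1 q.2 := by
    refine measurable_from_prod_countable_right fun B => Continuous.measurable ?_
    exact Continuous.const_smul (continuous_finsetSum _ fun j _ => hc (B j)) ((N : ℝ) / n)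
  refine measurable_pi_lambda _ fun h => ?_
  have h2 : Measurable fun q : Pair d × Noise n N d => batchGradient L q.2.1 (q.1 h) :=
    h1.comp (g := fun q : (Fin n → Fin N) × Param d => batchGradient L q.1 q.2)
      (f := fun q : Pair d × Noise n N d => (q.2.1, q.1 h)) (by fun_prop)
  unfold langevinStep
  fun_prop

open Classical in
/-- The swap step, as a function of the pair, the snapshot and the noise. -/
noncomputable def swapStep {n : ℕ} (L : Fin N → Param d → ℝ) (τ : Fin 2 → ℝ) (r η : ℝ)
    (x y : Pair d) (z : Noise n N d) : Pair d :=
  if z.2.2 < r * η * min 1 (vrSwapRate L τ z.1 x y) then fun h => x h.rev else x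

lemma SmoothDissipative.measurable_swapStep [NeZero N] {L : Fin N → Param d → ℝ} {CN a b : ℝ}
    (hL : SmoothDissipative L CN a b) (τ : Fin 2 → ℝ) (r η : ℝ) {n : ℕ} (hn : 1 ≤ n) :
    Measurable fun q : Pair d × Pair d × Noise n N d => swapStep L τ r η q.1 q.2.1 q.2.2 := by
  have h1 : Measurable fun q : Pair d × Pair d × Noise n N d =>
      vrSwapRate L τ q.2.2.1 q.1 q.2.1 :=
    (hL.measurable_vrSwapRate τ hn).comp
      (f := fun q : Pair d × Pair d × Noise n N d => (q.2.2.1, q.1, q.2.1)) (by fun_prop)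
  unfold swapStep
  refine Measurable.ite (measurableSet_lt (by fun_prop) (by fun_prop)) ?_ (by fun_prop)
  exact measurable_pi_lambda _ fun h => by fun_prop

lemma sqNorm_swapStep {n : ℕ} (L : Fin N → Param d → ℝ) (τ : Fin 2 → ℝ) (r η : ℝ)
    (x y : Pair d) (z : Noise n N d) : sqNorm (swapStep L τ r η x y z) = sqNorm x := by
  unfold swapStep
  split_ifs
  · exact sqNorm_rev x
  · rfl

/-- A swap moves the pair by at most twice its norm, and only if the uniform variable is below
the swapping intensity. -/
lemma sqNorm_swapStep_sub_le {n : ℕ} (L : Fin N → Param d → ℝ) (τ : Fin 2 → ℝ) {r η : ℝ}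
    (hrη : 0 ≤ r * η) (x y : Pair d) (z : Noise n N d) :
    ENNReal.ofReal (sqNorm (swapStep L τ r η x y z - x))
      ≤ 4 * (ENNReal.ofReal (sqNorm x) * (Set.Iio (r * η)).indicator 1 z.2.2) := by
  unfold swapStep
  split_ifs with h
  · have h1 : z.2.2 ∈ Set.Iio (r * η) :=
      h.trans_le (mul_le_of_le_one_right hrη (min_le_left _ _))
    rw [Set.indicator_of_mem h1, Pi.one_apply, mul_one]
    refine (ENNReal.ofReal_le_ofReal (sqNorm_rev_sub_le x)).trans ?_
    rw [ENNReal.ofReal_mul (by norm_num)]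
    simp
  · simp [sqNorm]

/-! ### The history of a run -/

/-- The randomness up to iteration `k`: the initial pair and the noise of the iterations up to
`k`. -/
def history {Ω : Type*} {n : ℕ} (ζ : ℕ → Ω → Noise n N d) (β : ℕ → Ω → Pair d) (k : ℕ) (ω : Ω) :
    Pair d × (Finset.range (k + 1) → Noise n N d) :=
  (β 0 ω, fun i => ζ i ω)

lemma comap_history_mono {Ω : Type*} {n : ℕ} {ζ : ℕ → Ω → Noise n N d} {β : ℕ → Ω → Pair d} :
    Monotone fun k => MeasurableSpace.comap (history ζ β k) inferInstance := by
  refine monotone_nat_of_le_succ fun k => ?_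
  have h : history ζ β k = (fun q : Pair d × (Finset.range (k + 2) → Noise n N d) =>
      (q.1, fun i : Finset.range (k + 1) =>
        q.2 ⟨i, Finset.mem_range.2 (Nat.lt_succ_of_lt (Finset.mem_range.1 i.2))⟩))
      ∘ history ζ β (k + 1) := rfl
  rw [h, ← MeasurableSpace.comap_comp]
  exact MeasurableSpace.comap_mono (Measurable.comap_le (by fun_prop))

lemma measurable_history_noise {Ω : Type*} {n : ℕ} (ζ : ℕ → Ω → Noise n N d)
    (β : ℕ → Ω → Pair d) (k : ℕ) :
    Measurable[MeasurableSpace.comap (history ζ β k) inferInstance] (ζ k) := by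
  have h : ζ k = (fun q : Pair d × (Finset.range (k + 1) → Noise n N d) =>
      q.2 ⟨k, by simp⟩) ∘ history ζ β k := rfl
  rw [h]
  exact Measurable.comp (by fun_prop) (comap_measurable _)

/-! ### Moments and displacements along a run -/

/-- Cauchy–Schwarz for the displacement over several iterations. -/
lemma sqNorm_sub_le_sum (p : ℕ → Pair d) (k l : ℕ) :
    sqNorm (p (k + l) - p k) ≤ l * ∑ j ∈ Finset.range l, sqNorm (p (k + (j + 1)) - p (k + j)) := by
  unfold sqNorm
  rw [Finset.sum_comm, Finset.mul_sum]
  refine Finset.sum_le_sum fun h _ => ?_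
  have h1 : (p (k + l) - p k) h = ∑ j ∈ Finset.range l, (p (k + (j + 1)) - p (k + j)) h := by
    rw [← Finset.sum_apply, Finset.sum_range_sub (fun j => p (k + j)), add_zero]
  rw [h1]
  calc _ ≤ (∑ j ∈ Finset.range l, ‖(p (k + (j + 1)) - p (k + j)) h‖) ^ 2 := by
        gcongr; exact norm_sum_le _ _
    _ ≤ _ := by
        simpa using sq_sum_le_card_mul_sum_sq (s := Finset.range l)
          (f := fun j => ‖(p (k + (j + 1)) - p (k + j)) h‖)

namespace IsRun

variable {Ω : Type*} [MeasurableSpace Ω] {P : Measure Ω} {L : Fin N → Param d → ℝ}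
  {τ : Fin 2 → ℝ} {r η : ℝ} {m n : ℕ} {ζ : ℕ → Ω → Noise n N d} {β post : ℕ → Ω → Pair d}

lemma succ_eq (hR : IsRun P L τ r η m n ζ β post) (k : ℕ) :
    β (k + 1) = fun ω => langevinStep L τ η (post k ω) (ζ (k + 1) ω) := by
  ext1 ω
  exact funext fun h => hR.langevin k ω h

lemma post_succ_eq (hR : IsRun P L τ r η m n ζ β post) (k : ℕ) :
    post (k + 1) = fun ω =>
      swapStep L τ r η (β (k + 1) ω) (β (m * ((k + 1) / m)) ω) (ζ (k + 1) ω) := by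
  ext1 ω
  exact hR.swap k ω

lemma sqNorm_post (hR : IsRun P L τ r η m n ζ β post) (k : ℕ) (ω : Ω) :
    sqNorm (post k ω) = sqNorm (β k ω) := by
  cases k with
  | zero => rw [hR.post_zero]
  | succ k => rw [hR.post_succ_eq, sqNorm_swapStep]

lemma indepFun_history [IsProbabilityMeasure P] (hR : IsRun P L τ r η m n ζ β post) (k : ℕ) :
    IndepFun (history ζ β k) (ζ (k + 1)) P := by
  have hζ := hR.measurable_noise
  refine indepFun_prodMk_left_of_indepFun hR.measurable_init (by fun_prop) (hζ _) ?_ ?_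
  · exact hR.indep_init.comp (φ := id)
      (ψ := fun f : ℕ → Noise n N d => ((fun i : Finset.range (k + 1) => f i), f (k + 1)))
      measurable_id (by fun_prop)
  · have h := hR.indep_noise.indepFun_finset (Finset.range (k + 1)) {k + 1} (by simp) hζ
    exact h.comp (φ := id)
      (ψ := fun f : ({k + 1} : Finset ℕ) → Noise n N d => f ⟨k + 1, by simp⟩)
      measurable_id (by fun_prop)

/-- The run is adapted: both the pair before and the pair after the swap are functions of the
history. -/
lemma measurable_history [NeZero N] {CN a b : ℝ} (hR : IsRun P L τ r η m n ζ β post)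
    (hL : SmoothDissipative L CN a b) (hn : 1 ≤ n) (k : ℕ) :
    Measurable[MeasurableSpace.comap (history ζ β k) inferInstance] (β k) ∧
      Measurable[MeasurableSpace.comap (history ζ β k) inferInstance] (post k) := by
  induction k using Nat.strong_induction_on with
  | _ k ih =>
  cases k with
  | zero =>
    have h : Measurable[MeasurableSpace.comap (history ζ β 0) inferInstance] (β 0) :=
      Measurable.comp (g := Prod.fst) measurable_fst (comap_measurable (history ζ β 0))
    exact ⟨h, hR.post_zero ▸ h⟩
  | succ k =>
    have hm := comap_history_mono (ζ := ζ) (β := β)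
    have hζ := measurable_history_noise ζ β (k + 1)
    have hβ : Measurable[MeasurableSpace.comap (history ζ β (k + 1)) inferInstance]
        (β (k + 1)) := by
      rw [hR.succ_eq]
      exact (hL.measurable_langevinStep τ η n).comp
        (((ih k k.lt_succ_self).2.mono (hm k.le_succ) le_rfl).prodMk hζ)
    refine ⟨hβ, ?_⟩
    have hsnap : Measurable[MeasurableSpace.comap (history ζ β (k + 1)) inferInstance]
        (β (m * ((k + 1) / m))) := by
      rcases (Nat.mul_div_le (k + 1) m).eq_or_lt with h | h
      · rw [h]; exact hβ
      · exact (ih _ h).1.mono (hm h.le) le_rfl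
    rw [hR.post_succ_eq]
    exact (hL.measurable_swapStep τ r η hn).comp (hβ.prodMk (hsnap.prodMk hζ))

lemma comap_history_le (hR : IsRun P L τ r η m n ζ β post) (k : ℕ) :
    MeasurableSpace.comap (history ζ β k) inferInstance ≤ ‹MeasurableSpace Ω› := by
  have hζ := hR.measurable_noise
  have h0 := hR.measurable_init
  refine Measurable.comap_le ?_
  unfold history
  fun_prop

lemma measurable [NeZero N] {CN a b : ℝ} (hR : IsRun P L τ r η m n ζ β post)
    (hL : SmoothDissipative L CN a b) (hn : 1 ≤ n) (k : ℕ) : Measurable (β k) :=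
  (hR.measurable_history hL hn k).1.mono (hR.comap_history_le k) le_rfl

lemma measurable_post [NeZero N] {CN a b : ℝ} (hR : IsRun P L τ r η m n ζ β post)
    (hL : SmoothDissipative L CN a b) (hn : 1 ≤ n) (k : ℕ) : Measurable (post k) :=
  (hR.measurable_history hL hn k).2.mono (hR.comap_history_le k) le_rfl

/-- The noise of iteration `k + 1` can be integrated out at a fixed value of `post k`. -/
lemma lintegral_step [IsProbabilityMeasure P] [NeZero N] {CN a b : ℝ}
    (hR : IsRun P L τ r η m n ζ β post) (hL : SmoothDissipative L CN a b) (hn : 1 ≤ n) (k : ℕ)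
    {F : Pair d × Noise n N d → ENNReal} (hF : Measurable F) :
    ∫⁻ ω, F (post k ω, ζ (k + 1) ω) ∂P
      = ∫⁻ ω, ∫⁻ z, F (post k ω, z) ∂(noiseLaw n N d) ∂P := by
  have hind : IndepFun (post k) (ζ (k + 1)) P := by
    rw [IndepFun_iff_Indep]
    exact indep_of_indep_of_le_left ((IndepFun_iff_Indep _ _ _).1 (hR.indepFun_history k))
      (measurable_iff_comap_le.1 (hR.measurable_history hL hn k).2)
  rw [lintegral_comp_of_indepFun (hR.measurable_post hL hn k) (hR.measurable_noise _) hind hF,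
    hR.law_noise]

/-- The second moment of the run is bounded, uniformly in the number of iterations, the batch
size, the snapshot period and the learning rate. -/
lemma lintegral_sqNorm_le [IsProbabilityMeasure P] [NeZero N] {CN a b G M : ℝ}
    (hR : IsRun P L τ r η m n ζ β post) (hL : SmoothDissipative L CN a b) (hn : 1 ≤ n)
    (hG : ∀ i x, ‖∇ (L i) x‖ ≤ CN * ‖x‖ + G) (hτ : ∀ h, 0 < τ h)
    (hη0 : 0 < η) (hη1 : η ≤ 1) (hη : η * (N * CN) ^ 2 ≤ a)
    (hM1 : 2 * growthConst N d G b τ / a ≤ M) (hM2 : growthConst N d G b τ ≤ M)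
    (h0 : ∫⁻ ω, ENNReal.ofReal (sqNorm (β 0 ω)) ∂P ≤ ENNReal.ofReal M) (k : ℕ) :
    ∫⁻ ω, ENNReal.ofReal (sqNorm (β k ω)) ∂P ≤ ENNReal.ofReal M := by
  have ha := hL.a_pos
  have hD := gaussianMoment_nonneg d
  have hK : 0 ≤ growthConst N d G b τ := by
    have hb := hL.b_nonneg
    exact Finset.sum_nonneg fun h _ => by have := hτ h; positivity
  set K := growthConst N d G b τ with hKdef
  induction k with
  | zero => exact h0
  | succ k ih =>
    have hstep := hR.lintegral_step hL hn k (F := fun q =>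
      ENNReal.ofReal (sqNorm (langevinStep L τ η q.1 q.2)))
      ((measurable_sqNorm.comp (hL.measurable_langevinStep τ η n)).ennreal_ofReal)
    rw [hR.succ_eq, hstep]
    set ρ := max 0 (1 - η * a / 2) with hρ
    have hρ0 : 0 ≤ ρ := le_max_left _ _
    calc _ ≤ ∫⁻ ω, (ENNReal.ofReal ρ * ENNReal.ofReal (sqNorm (β k ω))
          + ENNReal.ofReal (η * K)) ∂P := by
          refine lintegral_mono fun ω => ?_
          refine (hL.lintegral_sqNorm_langevinStep_le hn hG hτ hη0 hη1 hη _).trans ?_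
          rw [hR.sqNorm_post, ← ENNReal.ofReal_mul hρ0]
          have hs := sqNorm_nonneg (β k ω)
          rw [← ENNReal.ofReal_add (by positivity) (by positivity)]
          apply ENNReal.ofReal_le_ofReal
          gcongr
          exact le_max_right _ _
      _ ≤ ENNReal.ofReal ρ * ENNReal.ofReal M + ENNReal.ofReal (η * K) := by
          rw [lintegral_add_right _ measurable_const,
            lintegral_const_mul' _ _ ENNReal.ofReal_ne_top]
          simp only [lintegral_const, measure_univ, mul_one]
          gcongr
      _ ≤ ENNReal.ofReal M := by
          have hM0 : 0 ≤ M := hK.trans hM2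
          rw [← ENNReal.ofReal_mul hρ0, ← ENNReal.ofReal_add (by positivity) (by positivity)]
          apply ENNReal.ofReal_le_ofReal
          rcases max_cases 0 (1 - η * a / 2) with ⟨h, _⟩ | ⟨h, _⟩
          · rw [hρ, h]
            nlinarith
          · rw [hρ, h]
            rw [div_le_iff₀ ha] at hM1
            nlinarith

/-- The expected squared displacement in one iteration, swap included, is of the order of the
learning rate. -/
lemma lintegral_sqNorm_succ_sub_le [IsProbabilityMeasure P] [NeZero N] {CN a b G M : ℝ}
    (hR : IsRun P L τ r η m n ζ β post) (hL : SmoothDissipative L CN a b) (hn : 1 ≤ n)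
    (hG : ∀ i x, ‖∇ (L i) x‖ ≤ CN * ‖x‖ + G) (hτ : ∀ h, 0 < τ h) (hr : 0 ≤ r)
    (hη0 : 0 < η) (hη1 : η ≤ 1) (hη : η * (N * CN) ^ 2 ≤ a) (hM0 : 0 ≤ M)
    (hM : ∀ k, ∫⁻ ω, ENNReal.ofReal (sqNorm (β k ω)) ∂P ≤ ENNReal.ofReal M) (k : ℕ) :
    ∫⁻ ω, ENNReal.ofReal (sqNorm (β (k + 1) ω - β k ω)) ∂P
      ≤ ENNReal.ofReal (η * (2 * (3 / 2 * a * M + growthConst N d G b τ) + 8 * r * M)) := by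
  have ha := hL.a_pos
  have hD := gaussianMoment_nonneg d
  have hK : 0 ≤ growthConst N d G b τ := by
    have hb := hL.b_nonneg
    exact Finset.sum_nonneg fun h _ => by have := hτ h; positivity
  set K := growthConst N d G b τ with hKdef
  have hmL := hL.measurable_langevinStep τ η n
  -- the Langevin step
  have h1 : ∫⁻ ω, ENNReal.ofReal (sqNorm (β (k + 1) ω - post k ω)) ∂P
      ≤ ENNReal.ofReal (η * (3 / 2 * a * M + K)) := by
    have hstep := hR.lintegral_step hL hn k (F := fun q =>
      ENNReal.ofReal (sqNorm (langevinStep L τ η q.1 q.2 - q.1)))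
      ((measurable_sqNorm.comp (hmL.sub measurable_fst)).ennreal_ofReal)
    rw [hR.succ_eq, hstep]
    calc _ ≤ ∫⁻ ω, (ENNReal.ofReal (η * (3 / 2 * a)) * ENNReal.ofReal (sqNorm (β k ω))
          + ENNReal.ofReal (η * K)) ∂P := by
          refine lintegral_mono fun ω => ?_
          refine (lintegral_sqNorm_langevinStep_sub_le hn hL.b_nonneg hG hτ hη0 hη1 hη _).trans ?_
          have hs := sqNorm_nonneg (β k ω)
          rw [hR.sqNorm_post, ← ENNReal.ofReal_mul (by positivity),
            ← ENNReal.ofReal_add (by positivity) (by positivity)]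
          apply ENNReal.ofReal_le_ofReal
          apply le_of_eq
          ring
      _ ≤ ENNReal.ofReal (η * (3 / 2 * a)) * ENNReal.ofReal M + ENNReal.ofReal (η * K) := by
          rw [lintegral_add_right _ measurable_const,
            lintegral_const_mul' _ _ ENNReal.ofReal_ne_top]
          simp only [lintegral_const, measure_univ, mul_one]
          gcongr
          exact hM k
      _ = _ := by
          rw [← ENNReal.ofReal_mul (by positivity),
            ← ENNReal.ofReal_add (by positivity) (by positivity)]
          ring_nf
  -- the swap step
  have h2 : ∫⁻ ω, ENNReal.ofReal (sqNorm (post k ω - β k ω)) ∂P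
      ≤ ENNReal.ofReal (4 * (r * η * M)) := by
    cases k with
    | zero => simp [hR.post_zero, sqNorm]
    | succ k =>
      have hF : Measurable fun q : Pair d × Noise n N d =>
          ENNReal.ofReal (sqNorm (langevinStep L τ η q.1 q.2)) :=
        (measurable_sqNorm.comp hmL).ennreal_ofReal
      have hU : Measurable ((Set.Iio (r * η)).indicator (1 : ℝ → ENNReal)) :=
        measurable_one.indicator measurableSet_Iio
      calc _ ≤ ∫⁻ ω, 4 * (ENNReal.ofReal (sqNorm (β (k + 1) ω))
            * (Set.Iio (r * η)).indicator 1 (ζ (k + 1) ω).2.2) ∂P := by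
            refine lintegral_mono fun ω => ?_
            rw [hR.post_succ_eq]
            exact sqNorm_swapStep_sub_le L τ (by positivity) _ _ _
        _ = 4 * ∫⁻ ω, ∫⁻ z : Noise n N d, ENNReal.ofReal (sqNorm (langevinStep L τ η (post k ω) z))
            * (Set.Iio (r * η)).indicator 1 z.2.2 ∂(noiseLaw n N d) ∂P := by
            rw [lintegral_const_mul' _ _ (by simp), ← hR.lintegral_step hL hn k (F := fun q =>
              ENNReal.ofReal (sqNorm (langevinStep L τ η q.1 q.2))
                * (Set.Iio (r * η)).indicator 1 q.2.2.2) (by fun_prop)]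
            rw [hR.succ_eq]
        _ ≤ 4 * ∫⁻ ω, ENNReal.ofReal (r * η) * ∫⁻ z : Noise n N d,
            ENNReal.ofReal (sqNorm (langevinStep L τ η (post k ω) z)) ∂(noiseLaw n N d) ∂P := by
            gcongr with ω
            refine lintegral_mul_indicator_uniform_le n N d (F := fun q =>
              ENNReal.ofReal (sqNorm (langevinStep L τ η (post k ω) (q.1, q.2, 0)))) ?_ (r * η)
            exact hF.comp (f := fun q : (Fin n → Fin N) × (Fin 2 → Param d) =>
              (post k ω, q.1, q.2, (0 : ℝ))) (by fun_prop)
        _ = 4 * (ENNReal.ofReal (r * η) * ∫⁻ ω, ENNReal.ofReal (sqNorm (β (k + 1) ω)) ∂P) := by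
            rw [lintegral_const_mul' _ _ ENNReal.ofReal_ne_top, ← hR.lintegral_step hL hn k hF,
              hR.succ_eq]
        _ ≤ 4 * (ENNReal.ofReal (r * η) * ENNReal.ofReal M) := by
            gcongr
            exact hM _
        _ = _ := by
            rw [← ENNReal.ofReal_mul (by positivity), ENNReal.ofReal_mul (p := 4) (by norm_num)]
            simp
  have hβ := hR.measurable hL hn
  have hpost := hR.measurable_post hL hn
  calc _ ≤ ∫⁻ ω, (2 * ENNReal.ofReal (sqNorm (β (k + 1) ω - post k ω))
        + 2 * ENNReal.ofReal (sqNorm (post k ω - β k ω))) ∂P := by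
        refine lintegral_mono fun ω => ?_
        have h := sqNorm_add_le (β (k + 1) ω - post k ω) (post k ω - β k ω)
        rw [sub_add_sub_cancel] at h
        refine (ENNReal.ofReal_le_ofReal h).trans ?_
        have ha1 := sqNorm_nonneg (β (k + 1) ω - post k ω)
        have ha2 := sqNorm_nonneg (post k ω - β k ω)
        rw [ENNReal.ofReal_add (by positivity) (by positivity),
          ENNReal.ofReal_mul (by norm_num), ENNReal.ofReal_mul (by norm_num)]
        simp
    _ = 2 * ∫⁻ ω, ENNReal.ofReal (sqNorm (β (k + 1) ω - post k ω)) ∂P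
        + 2 * ∫⁻ ω, ENNReal.ofReal (sqNorm (post k ω - β k ω)) ∂P := by
        rw [lintegral_add_right _ (by fun_prop), lintegral_const_mul' _ _ (by simp),
          lintegral_const_mul' _ _ (by simp)]
    _ ≤ 2 * ENNReal.ofReal (η * (3 / 2 * a * M + K)) + 2 * ENNReal.ofReal (4 * (r * η * M)) := by
        gcongr
    _ = _ := by
        rw [show (2 : ENNReal) = ENNReal.ofReal 2 by simp, ← ENNReal.ofReal_mul (by norm_num),
          ← ENNReal.ofReal_mul (by norm_num), ← ENNReal.ofReal_add (by positivity) (by positivity)]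
        ring_nf

lemma lintegral_sqNorm_sub_snapshot_le [NeZero N] {CN a b D : ℝ}
    (hR : IsRun P L τ r η m n ζ β post) (hL : SmoothDissipative L CN a b) (hn : 1 ≤ n)
    (hm : 1 ≤ m) (hη : 0 ≤ η) (hD0 : 0 ≤ D)
    (hD : ∀ k, ∫⁻ ω, ENNReal.ofReal (sqNorm (β (k + 1) ω - β k ω)) ∂P ≤ ENNReal.ofReal (η * D))
    (k : ℕ) :
    ∫⁻ ω, ENNReal.ofReal (sqNorm (β k ω - β (m * (k / m)) ω)) ∂P
      ≤ ENNReal.ofReal ((m : ℝ) ^ 2 * η * D) := by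
  have hβ := hR.measurable hL hn
  set k₀ := m * (k / m) with hk₀
  have hk : k₀ + k % m = k := Nat.div_add_mod k m
  have hl : ((k % m : ℕ) : ℝ) ≤ m := by exact_mod_cast (Nat.mod_lt k (by omega)).le
  generalize k % m = l at hk hl
  rw [← hk]
  calc _ ≤ ∫⁻ ω, ENNReal.ofReal l * ∑ j ∈ Finset.range l,
        ENNReal.ofReal (sqNorm (β (k₀ + (j + 1)) ω - β (k₀ + j) ω)) ∂P := by
        refine lintegral_mono fun ω => ?_
        refine (ENNReal.ofReal_le_ofReal (sqNorm_sub_le_sum (fun j => β j ω) k₀ l)).trans ?_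
        rw [ENNReal.ofReal_mul (by positivity),
          ENNReal.ofReal_sum_of_nonneg fun j _ => sqNorm_nonneg _]
    _ = ENNReal.ofReal l * ∑ j ∈ Finset.range l,
        ∫⁻ ω, ENNReal.ofReal (sqNorm (β (k₀ + (j + 1)) ω - β (k₀ + j) ω)) ∂P := by
        rw [lintegral_const_mul' _ _ ENNReal.ofReal_ne_top,
          lintegral_finsetSum _ fun j _ => by fun_prop]
    _ ≤ ENNReal.ofReal l * ∑ j ∈ Finset.range l, ENNReal.ofReal (η * D) := by
        gcongr with j
        exact hD (k₀ + j)
    _ = ENNReal.ofReal (l * (l * (η * D))) := by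
        rw [ENNReal.ofReal_mul (p := (l : ℝ)) (by positivity),
          ENNReal.ofReal_mul (p := (l : ℝ)) (by positivity)]
        simp
    _ ≤ _ := by
        apply ENNReal.ofReal_le_ofReal
        calc (l : ℝ) * (l * (η * D)) ≤ m * (m * (η * D)) := by gcongr
          _ = _ := by ring

end IsRun

/-! ### The log-variance along the algorithm -/

/-- The expected log-variance is of the order of the squared distance from the snapshot, divided
by the batch size, and that distance is of order `m √η`. -/
theorem SmoothDissipative.exists_lintegral_logVariance_le [NeZero N] {L : Fin N → Param d → ℝ}
    {CN a b : ℝ} (hL : SmoothDissipative L CN a b) {τ : Fin 2 → ℝ} (hτ : ∀ h, 0 < τ h) {r : ℝ}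
    (hr : 0 ≤ r) (M₀ R : ℝ) :
    ∃ C : ℝ, ∀ (n m : ℕ) (η : ℝ), 1 ≤ n → 1 ≤ m → 0 < η → η < min 1 (a / (N * CN) ^ 2) →
      ∀ {Ω : Type*} [MeasurableSpace Ω] (P : Measure Ω) [IsProbabilityMeasure P]
        (ζ : ℕ → Ω → Noise n N d) (β post : ℕ → Ω → Pair d),
        IsRun P L τ r η m n ζ β post →
        (∀ h, ∫⁻ ω, ENNReal.ofReal (‖β 0 ω h‖ ^ 2) ∂P ≤ ENNReal.ofReal M₀) →
        ∀ k : ℕ,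
          ∫⁻ ω in {ω | ∀ h, ‖β k ω h‖ ≤ R ∧ ‖β (m * (k / m)) ω h‖ ≤ R},
            ENNReal.ofReal (logVariance L τ n (β k ω) (β (m * (k / m)) ω)) ∂P
          ≤ ENNReal.ofReal (C * ((m : ℝ) ^ 2 * η / n)) := by
  obtain ⟨G, hG0, hG⟩ := hL.exists_norm_gradient_le
  have ha := hL.a_pos
  have hb := hL.b_nonneg
  have hCN := hL.CN_pos
  have hgm := gaussianMoment_nonneg d
  have hN : (0 : ℝ) < N := by exact_mod_cast NeZero.pos N
  have hK : 0 ≤ growthConst N d G b τ :=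
    Finset.sum_nonneg fun h _ => by have := hτ h; positivity
  set K := growthConst N d G b τ with hKdef
  set M := 2 * |M₀| + 2 * K / a + K with hM
  have hq : 0 ≤ 2 * K / a := by positivity
  have hM00 : 0 ≤ |M₀| := abs_nonneg _
  have hM0 : 0 ≤ M := by positivity
  set D := 2 * (3 / 2 * a * M + K) + 8 * r * M with hD
  have hD0 : 0 ≤ D := by positivity
  set c := 2 * (2 * N * |invTempGap τ| * (CN * R + G)) ^ 2 with hc
  have hc0 : 0 ≤ c := by positivity
  refine ⟨c * D, ?_⟩
  intro n m η hn hm hη0 hη Ω _ P _ ζ β post hR hinit k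
  have hη1 : η ≤ 1 := (hη.trans_le (min_le_left _ _)).le
  have hηa : η * (N * CN) ^ 2 ≤ a := by
    have := hη.trans_le (min_le_right _ _)
    rw [lt_div_iff₀ (by positivity)] at this
    exact this.le
  have hβ := hR.measurable hL hn
  have hinit' : ∫⁻ ω, ENNReal.ofReal (sqNorm (β 0 ω)) ∂P ≤ ENNReal.ofReal M := by
    have hβ0 := hβ 0
    unfold sqNorm
    simp_rw [ENNReal.ofReal_sum_of_nonneg fun h _ => sq_nonneg _]
    rw [lintegral_finsetSum _ fun h _ => by fun_prop]
    calc _ ≤ ∑ _ : Fin 2, ENNReal.ofReal |M₀| :=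
          Finset.sum_le_sum fun h _ =>
            (hinit h).trans (ENNReal.ofReal_le_ofReal (le_abs_self _))
      _ = ENNReal.ofReal (2 * |M₀|) := by
          rw [ENNReal.ofReal_mul (by norm_num)]; simp
      _ ≤ _ := ENNReal.ofReal_le_ofReal (by linarith)
  have hmom := hR.lintegral_sqNorm_le hL hn hG hτ hη0 hη1 hηa (M := M) (by linarith)
    (by linarith) hinit'
  have hinc := hR.lintegral_sqNorm_succ_sub_le hL hn hG hτ hr hη0 hη1 hηa hM0 hmom
  have hsnap := hR.lintegral_sqNorm_sub_snapshot_le hL hn hm hη0.le hD0 hinc k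
  set k₀ := m * (k / m) with hk₀
  have hβk := hβ k
  have hβk₀ := hβ k₀
  have hS : MeasurableSet {ω | ∀ h, ‖β k ω h‖ ≤ R ∧ ‖β k₀ ω h‖ ≤ R} := by
    simp only [Set.ofPred_forall, Set.ofPred_and]
    refine MeasurableSet.iInter fun h => ?_
    exact (measurableSet_le (by fun_prop) measurable_const).inter
      (measurableSet_le (by fun_prop) measurable_const)
  calc _ ≤ ∫⁻ ω in {ω | ∀ h, ‖β k ω h‖ ≤ R ∧ ‖β k₀ ω h‖ ≤ R},
        ENNReal.ofReal (c / n) * ENNReal.ofReal (sqNorm (β k ω - β k₀ ω)) ∂P := by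
        refine setLIntegral_mono' hS fun ω hω => ?_
        rw [← ENNReal.ofReal_mul (by positivity)]
        exact ENNReal.ofReal_le_ofReal (hL.logVariance_le_dist hG τ hn hω)
    _ ≤ ∫⁻ ω, ENNReal.ofReal (c / n) * ENNReal.ofReal (sqNorm (β k ω - β k₀ ω)) ∂P :=
        setLIntegral_le_lintegral _ _
    _ ≤ ENNReal.ofReal (c / n) * ENNReal.ofReal ((m : ℝ) ^ 2 * η * D) := by
        rw [lintegral_const_mul' _ _ ENNReal.ofReal_ne_top]
        gcongr
    _ = _ := by
        rw [← ENNReal.ofReal_mul (by positivity)]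
        congr 1
        ring

end VRReSGLD

open VRReSGLD in
theorem lemma2 {N d : ℕ} (hN : 0 < N) (L : Fin N → Param d → ℝ) (CN a b : ℝ)
    (hL : SmoothDissipative L CN a b) (τ : Fin 2 → ℝ) (hτ0 : 0 < τ 0) (hτ1 : τ 0 < τ 1)
    (r : ℝ) (hr : 0 ≤ r) (M₀ : ℝ) (R : ℝ) :
    ∃ A C : ℝ, 0 < A ∧ 0 < C ∧
      -- the expected truncated rate at given parameters and snapshots in the ball of radius `R`
      (∀ n : ℕ, 1 ≤ n → ∀ x y : Pair d, (∀ h, ‖x h‖ ≤ R ∧ ‖y h‖ ≤ R) →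
        logVariance L τ n x y ≤ C / n ∧
        expTruncSwapRate L τ n x y ≤ approxRate L τ A n x y ∧
        Real.exp (-(C * (√(logVariance L τ n x y) + 1 / (n : ℝ) ^ 2))) * approxRate L τ A n x y
          ≤ expTruncSwapRate L τ n x y) ∧
      -- the exponent is of order `m² η / n` along the algorithm
      (∀ (n m : ℕ) (η : ℝ), 1 ≤ n → 1 ≤ m → 0 < η → η < min 1 (a / (N * CN) ^ 2) →
        ∀ {Ω : Type*} [MeasurableSpace Ω] (P : Measure Ω) [IsProbabilityMeasure P]
          (ζ : ℕ → Ω → Noise n N d) (β post : ℕ → Ω → Pair d),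
          IsRun P L τ r η m n ζ β post →
          (∀ h, ∫⁻ ω, ENNReal.ofReal (‖β 0 ω h‖ ^ 2) ∂P ≤ ENNReal.ofReal M₀) →
          ∀ k : ℕ,
            ∫⁻ ω in {ω | ∀ h, ‖β k ω h‖ ≤ R ∧ ‖β (m * (k / m)) ω h‖ ≤ R},
              ENNReal.ofReal (logVariance L τ n (β k ω) (β (m * (k / m)) ω)) ∂P
            ≤ ENNReal.ofReal (C * ((m : ℝ) ^ 2 * η / n))) := by
  have : NeZero N := ⟨hN.ne'⟩
  have hτ : ∀ h, 0 < τ h := by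
    intro h
    fin_cases h
    exacts [hτ0, hτ0.trans hτ1]
  obtain ⟨A, C₁, hA, hC₁, h1⟩ := hL.exists_approxRate_bounds τ R
  obtain ⟨C₂, h2⟩ := hL.exists_lintegral_logVariance_le hτ hr M₀ R
  refine ⟨A, max C₁ C₂, hA, lt_max_of_lt_left hC₁, fun n hn x y hxy => ?_, ?_⟩
  · obtain ⟨hv, hu, hl⟩ := h1 n hn x y hxy
    refine ⟨hv.trans (by gcongr; exact le_max_left _ _), hu, le_trans ?_ hl⟩
    refine mul_le_mul_of_nonneg_right ?_ (approxRate_nonneg L τ hA.le n x y)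
    gcongr
    exact le_max_left _ _
  · intro n m η hn hm hη0 hη Ω _ P _ ζ β post hR hinit k
    refine (h2 n m η hn hm hη0 hη P ζ β post hR hinit k).trans ?_
    gcongr
    exact le_max_right _ _
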